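/- Let $X$ be a set of inputs, let every update $u$ act as a function $X\to X$, and let $g:X\to[-U,-\frac1U]\cup\{0\}\cup[\frac1U,U]$ with $U>1$. Call $z$ a $\gamma$-approximation of $a$ if $a\le z\le\gamma a$ (for $a\ge 0$), respectively $\gamma a\le z\le a$ (for $a<0$). A dynamic algorithm $\mathcal A$ draws a random seed $r$ from a discrete distribution, preprocesses an initial input, and then processes updates; given $r$ it is deterministic, a query is read-only and returns a real number, and every operation takes a positive integer amount of time. Let $T\ge 1$, and suppose that $\mathcal A$ has the following guarantees against an oblivious adversary. - For every seed, every initial input $x_0$ and every sequence of $T$ updates, the preprocessing and all updates together take time at most $t_{\mathrm{total}}$. - For every seed, every $x_0$ and all $u_1,\dots,u_i$ with $0\le i\le T$, a query after these updates takes time at most $t_q$; and for all fixed $x_0,u_1,\dots,u_i$ with $0\le i\le T$, with probability at least $9/10$ over the seed, the answer is a $\gamma$-approximation of $g(x_i)$, where $x_i=u_i(x_{i-1})$. Then, for all parameters $\delta_{\mathrm{fail}},\alpha>0$, there is an algorithm $\mathcal A'$ against an adaptive adversary with the properties below. In the game, the (possibly randomized) adversary chooses $x_0$, $\mathcal A'$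 preprocesses it, and in each round the adversary chooses an update depending on $x_0$ and on all previous updates and outputs; $\mathcal A'$ processes it and outputs a number. Write $$L=\log\Bigl(2+T\,(1+\log U)\bigl(1+\tfrac1\alpha\bigr)\bigl(1+\tfrac1{\delta_{\mathrm{fail}}}\bigr)\Bigr).$$ There are absolute constants $C$ and $k$ such that, against every adaptive adversary: 1. in a game of $T$ updates, with probability at least $1-\delta_{\mathrm{fail}}$ all $T$ outputs are $\gamma(1+\alpha)$-approximations of $g$ at the current inputs, and the total time of $\mathcal A'$ is always at most $C L^k\,(\sqrt T\cdot t_{\mathrm{total}}+T\cdot t_q)$; 2. the same $\mathcal A'$ runs for any number $n$ of updates: for every phase of $T$ consecutive updates (updates $mT+1,\dots,(m+1)T$, as far as they occur), with probability at least $1-\delta_{\mathrm{fail}}$ all outputs in the phase are $\gamma(1+\alpha)$-approximations of $g$ at the current inputs, and the total time for the $n$ updates is always at most $C L^k\,(t_{\mathrm{total}}/\sqrt T+t_q)\cdot\max(n,T)$, that is, $C L^k(t_{\mathrm{total}}/\sqrt T+t_q)$ amortized per update for $n\ge T$. Here $\mathcal A'$ is a black-box reduction: a randomized real-RAM program of length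 at most $C$ (unit-cost addition, truncated subtraction and comparison of natural numbers, arithmetic and comparison of reals, indirect addressing, bounded loops, fair coin flips, numerical constants) that may start copies of $\mathcal A$ with independent fresh seeds on the current input, feed the current update to a copy, and query a copy, at the cost of the time that the copy takes plus the program's own steps; the program depends only on $T,U,\alpha,\delta_{\mathrm{fail}}$, and not on $X$, $g$, $\mathcal A$, $\gamma$, $t_{\mathrm{total}}$ or $t_q$. -/

import Mathlib

open scoped ENNReal

/-! ### Problems and approximation -/

/-- The input after the updates `us`, in this order, starting from `x`; `act u` is the function
`X → X` that the update `u` denotes. -/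
def inputAfter {X Upd : Type*} (act : Upd → X → X) (x : X) (us : List Upd) : X :=
  us.foldl (fun y u => act u y) x

/-- `z` is a `γ`-approximation of `a`: `a ≤ z ≤ γ a` if `a ≥ 0`, and the mirror image
`γ a ≤ z ≤ a` if `a < 0`. -/
def IsApprox (γ a z : ℝ) : Prop :=
  (0 ≤ a → a ≤ z ∧ z ≤ γ * a) ∧ (a < 0 → γ * a ≤ z ∧ z ≤ a)

/-! ### Dynamic algorithms and their guarantee against an oblivious adversary -/

/-- A randomized dynamic algorithm with its running times. All random bits form the seed, which is
drawn once, before the preprocessing; given the seed, the algorithm is deterministic, and the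
internal state may contain the seed. A query reads the state. Every operation takes a positive
number of time units. -/
structure DynAlg (X : Type*) (Upd : Type*) where
  Seed : Type*
  State : Type*
  seed : PMF Seed
  init : Seed → X → State
  initTime : Seed → X → ℕ+
  update : State → Upd → State
  updateTime : State → Upd → ℕ+
  query : State → ℝ
  queryTime : State → ℕ+

namespace DynAlg

variable {X Upd : Type*}

/-- The state after preprocessing `x` and then processing the updates `us`. -/
def stateAfter (A : DynAlg X Upd) (r : A.Seed) (x : X) (us : List Upd) : A.State :=
  us.foldl A.update (A.init r x)

/-- The time for processing the updates `us` from the state `s`. -/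
def updatesTime (A : DynAlg X Upd) : A.State → List Upd → ℕ
  | _, [] => 0
  | s, u :: us => (A.updateTime s u : ℕ) + A.updatesTime (A.update s u) us

/-- The preprocessing time plus the time for all updates. -/
def totalTime (A : DynAlg X Upd) (r : A.Seed) (x : X) (us : List Upd) : ℕ :=
  (A.initTime r x : ℕ) + A.updatesTime (A.init r x) us

/-- The guarantee against an oblivious adversary: the input and the updates are fixed before the
seed is drawn. -/
structure ObliviousGuarantee (A : DynAlg X Upd) (act : Upd → X → X) (g : X → ℝ)
    (T : ℕ) (γ : ℝ) (tTotal tq : ℕ) : Prop where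
  total_time : ∀ r ∈ A.seed.support, ∀ (x : X) (us : List Upd), us.length = T →
    A.totalTime r x us ≤ tTotal
  query_time : ∀ r ∈ A.seed.support, ∀ (x : X) (us : List Upd), us.length ≤ T →
    (A.queryTime (A.stateAfter r x us) : ℕ) ≤ tq
  accurate : ∀ (x : X) (us : List Upd), us.length ≤ T →
    9 / 10 ≤ A.seed.toOuterMeasure
      {r | IsApprox γ (g (inputAfter act x us)) (A.query (A.stateAfter r x us))}

end DynAlg

/-! ### Randomized real-RAM programs that run copies of a given dynamic algorithm

A program has a memory of natural numbers, a memory of real numbers (both with indirect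
addressing), and numbered slots that hold copies of the given algorithm. Its only source of
randomness of its own is fair coin flips. It can reach the input and the updates only through its
copies. -/

/-- Integer expressions; subtraction is truncated at `0`. -/
inductive NExpr where
  | lit (n : ℕ)
  | get (a : NExpr)
  | add (a b : NExpr)
  | sub (a b : NExpr)

/-- Real expressions; `get a` is the real memory cell whose address is the value of `a`. -/
inductive RExpr where
  | lit (r : ℝ)
  | get (a : NExpr)
  | add (a b : RExpr)
  | sub (a b : RExpr)
  | mul (a b : RExpr)
  | div (a b : RExpr)

/-- Tests. -/
inductive Test where
  | ltN (a b : NExpr)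
  | ltR (a b : RExpr)

/-- Statements. `setN`, `setR` assign to the memory cell with address `a`, `flip a` puts a fair
random bit there, and `loop n body` evaluates `n` once and then runs `body` that many times.
`start j` puts into slot `j` a copy of the given algorithm with a fresh seed, preprocessed on the
current input; `feed j` lets the copy in slot `j` process the current update; `ask j a` queries
the copy in slot `j` and puts the answer into the real memory cell with address `a`. -/
inductive Stmt where
  | skip
  | setN (a e : NExpr)
  | setR (a : NExpr) (e : RExpr)
  | flip (a : NExpr)
  | seq (s t : Stmt)
  | ite (c : Test) (s t : Stmt)
  | loop (n : NExpr) (body : Stmt)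
  | start (j : NExpr)
  | feed (j : NExpr)
  | ask (j a : NExpr)

/-- A program: `init` runs once, before the first update; `step` runs after every update, and what
it leaves in the real memory cell `0` is the output. -/
structure Program where
  init : Stmt
  step : Stmt

namespace NExpr

/-- The number of nodes, which is also the time for an evaluation. -/
def size : NExpr → ℕ
  | lit _ => 1
  | get a => a.size + 1
  | add a b => a.size + b.size + 1
  | sub a b => a.size + b.size + 1

/-- The value of an expression in the integer memory `N`. -/
def eval (N : ℕ → ℕ) : NExpr → ℕ
  | lit n => n
  | get a => N (a.eval N)
  | add a b => a.eval N + b.eval N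
  | sub a b => a.eval N - b.eval N

end NExpr

namespace RExpr

/-- The number of nodes, which is also the time for an evaluation. -/
def size : RExpr → ℕ
  | lit _ => 1
  | get a => a.size + 1
  | add a b => a.size + b.size + 1
  | sub a b => a.size + b.size + 1
  | mul a b => a.size + b.size + 1
  | div a b => a.size + b.size + 1

/-- The value of an expression in the integer memory `N` and the real memory `R`. -/
noncomputable def eval (N : ℕ → ℕ) (R : ℕ → ℝ) : RExpr → ℝ
  | lit r => r
  | get a => R (a.eval N)
  | add a b => a.eval N R + b.eval N R
  | sub a b => a.eval N R - b.eval N R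
  | mul a b => a.eval N R * b.eval N R
  | div a b => a.eval N R / b.eval N R

end RExpr

namespace Test

/-- The number of nodes, which is also the time for an evaluation. -/
def size : Test → ℕ
  | ltN a b => a.size + b.size + 1
  | ltR a b => a.size + b.size + 1

/-- The truth of a test in the integer memory `N` and the real memory `R`. -/
def Holds (N : ℕ → ℕ) (R : ℕ → ℝ) : Test → Prop
  | ltN a b => a.eval N < b.eval N
  | ltR a b => a.eval N R < b.eval N R

end Test

/-- The length of the text of a statement. -/
def Stmt.size : Stmt → ℕ
  | skip => 1
  | setN a e => a.size + e.size + 1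
  | setR a e => a.size + e.size + 1
  | flip a => a.size + 1
  | seq s t => s.size + t.size + 1
  | ite c s t => c.size + s.size + t.size + 1
  | loop n body => n.size + body.size + 1
  | start j => j.size + 1
  | feed j => j.size + 1
  | ask j a => j.size + a.size + 1

/-- The length of the text of a program. -/
def Program.size (P : Program) : ℕ := P.init.size + P.step.size

/-- The memory of a program that runs copies with states in `S`. -/
structure Mem (S : Type*) where
  nat : ℕ → ℕ
  real : ℕ → ℝ
  slot : ℕ → Option S

/-- The memory before the program is started. -/
def Mem.blank {S : Type*} : Mem S := ⟨fun _ => 0, fun _ => 0, fun _ => none⟩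

/-- Run `f` on the memory `n` times in a row, adding up the times, with one time unit per round
for the control of the loop. -/
noncomputable def iterRun {M : Type*} (f : M → PMF (M × ℕ)) : ℕ → M → PMF (M × ℕ)
  | 0, m => PMF.pure (m, 0)
  | n + 1, m => (f m).bind fun p => (iterRun f n p.1).map fun q => (q.1, p.2 + q.2 + 1)

open Classical in
/-- The joint distribution of the memory after running a statement and of the time that this
takes, given the current input `x` and the current update `u` (`none` before the first update).
A call to a copy costs the time that the copy takes for it, besides the overhead. A call to an
empty slot has no effect. -/
noncomputable def Stmt.exec {X Upd : Type*} (A : DynAlg X Upd) (x : X) (u : Option Upd) :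
    Stmt → Mem A.State → PMF (Mem A.State × ℕ)
  | skip, m => PMF.pure (m, 1)
  | setN a e, m =>
      PMF.pure ({ m with nat := Function.update m.nat (a.eval m.nat) (e.eval m.nat) },
        a.size + e.size + 1)
  | setR a e, m =>
      PMF.pure ({ m with real := Function.update m.real (a.eval m.nat) (e.eval m.nat m.real) },
        a.size + e.size + 1)
  | flip a, m =>
      (PMF.uniformOfFintype (Fin 2)).map fun b =>
        ({ m with nat := Function.update m.nat (a.eval m.nat) (b : ℕ) }, a.size + 1)
  | seq s t, m =>
      (s.exec A x u m).bind fun p => (t.exec A x u p.1).map fun q => (q.1, p.2 + q.2)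
  | ite c s t, m =>
      (if c.Holds m.nat m.real then s.exec A x u m else t.exec A x u m).map
        fun q => (q.1, c.size + q.2 + 1)
  | loop n body, m =>
      (iterRun (body.exec A x u) (n.eval m.nat) m).map fun q => (q.1, n.size + q.2 + 1)
  | start j, m =>
      A.seed.map fun r =>
        ({ m with slot := Function.update m.slot (j.eval m.nat) (some (A.init r x)) },
          j.size + A.initTime r x + 1)
  | feed j, m =>
      match m.slot (j.eval m.nat), u with
      | some s, some v =>
          PMF.pure
            ({ m with slot := Function.update m.slot (j.eval m.nat) (some (A.update s v)) },
              j.size + A.updateTime s v + 1)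
      | _, _ => PMF.pure (m, j.size + 1)
  | ask j a, m =>
      match m.slot (j.eval m.nat) with
      | some s =>
          PMF.pure ({ m with real := Function.update m.real (a.eval m.nat) (A.query s) },
            j.size + a.size + A.queryTime s + 1)
      | none => PMF.pure (m, j.size + a.size + 1)

/-! ### The game with an adaptive adversary -/

/-- One round of the game: the update, the input after it, and the output of the algorithm. -/
structure Round (X : Type*) (Upd : Type*) where
  update : Upd
  input : X
  output : ℝ

/-- A (possibly randomized) adaptive adversary: it chooses the initial input, and then every update
depending on the initial input and on all previous updates and outputs. -/
structure Adversary (X : Type*) (Upd : Type*) where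
  first : PMF X
  next : X → List (Round X Upd) → PMF Upd

/-- A position of the game: initial and current input, the rounds so far (oldest first), the
memory of the program, and the total time that the program has used. -/
structure Position (X : Type*) (Upd : Type*) (S : Type*) where
  initial : X
  current : X
  rounds : List (Round X Upd)
  mem : Mem S
  time : ℕ

/-- The distribution of the position after `n` rounds, when the program `P` runs copies of `A`
against the adversary `adv`. -/
noncomputable def Program.play {X Upd : Type*} (P : Program) (A : DynAlg X Upd)
    (act : Upd → X → X) (adv : Adversary X Upd) : ℕ → PMF (Position X Upd A.State)
  | 0 =>
      adv.first.bind fun x =>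
        (P.init.exec A x none Mem.blank).map fun q => ⟨x, x, [], q.1, q.2⟩
  | n + 1 =>
      (P.play A act adv n).bind fun p =>
        (adv.next p.initial p.rounds).bind fun u =>
          (P.step.exec A (act u p.current) (some u) p.mem).map fun q =>
            ⟨p.initial, act u p.current,
              p.rounds ++ [⟨u, act u p.current, q.1.real 0⟩], q.1, p.time + q.2⟩

/-- The rounds with indices in `s` (the first round has index `0`) have outputs that are
`γ`-approximations of `g` at the current inputs. -/
def AccurateOn {X Upd : Type*} (g : X → ℝ) (γ : ℝ) (s : Set ℕ) (l : List (Round X Upd)) : Prop :=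
  ∀ (i : ℕ) (h : i < l.length), i ∈ s → IsApprox γ (g l[i].input) l[i].output

/-- The quantity whose polylogarithm is hidden by `Õ`. -/
noncomputable def polylogArg (T : ℕ) (U α δ : ℝ) : ℝ :=
  2 + T * (1 + Real.log U) * (1 + 1 / α) * (1 + 1 / δ)

/-!
# A reduction from adaptive to oblivious adversaries

The program runs `k = 2 ^ w` copies of the given algorithm, restarted in every phase of `T` rounds,
where `k` is about `√T` up to logarithmic factors. It answers by a binary search on a geometric
grid, once for positive and once for negative values. Every step of the search compares a threshold
with the median answer, by a majority vote among a few random samples. A sample queries one random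
copy and keeps one noisy bit of the answer; everything else about the sample is erased. So the
adversary learns nothing about the seeds but these bits.

If fewer than two fifths of the copies are inaccurate, then every vote is right except with an
exponentially small probability (`countVotes_triple`), and right votes give an accurate output
(`searchBoth_triple`). So it has to be shown that, although the updates depend on earlier outputs,
many copies are rarely inaccurate at the same time.

Fix a set `S` of `M` copies, and compare the run with the one in which the slots of `S` are empty.
A single bit of the one run has a `χ²`-divergence of order `(M / k)²` from the bit of the other run,
since a sample hits `S` with probability `M / k` and the noise keeps all probabilities away from
`0`. By Cauchy–Schwarz, which composes along a program (`SqBound`), this gives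
`(E f)² ≤ c * E' (f²)` for the expectations in the two runs, where `c` is bounded, because there are
at most `(k / M)²` samples in a phase. In the second run the seeds of `S` are independent of the
transcript, so all copies in `S` are inaccurate with probability at most `10 ^ (-M)`
(`expect_all_bad_unused`), and in the true run with probability at most `√c * 10 ^ (-M / 2)`. But if
two fifths of all copies are inaccurate, then so are all members of a fraction of about
`(2 / 5) ^ M` of the sets `S`; as `2 / 5 > 10 ^ (-1 / 2)`, this is exponentially unlikely in `M`
(`expect_many_bad_sq_le`).

The running time is bounded along all runs by an invariant of the positions of the game (`PlayInv`).
-/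

/-! ### Expectations -/

/-- The expectation of a `[0, ∞]`-valued function under a discrete distribution. -/
noncomputable def expect {α : Type*} (p : PMF α) (f : α → ℝ≥0∞) : ℝ≥0∞ := ∑' a, p a * f a

/-- The indicator of a proposition, with values in `[0, ∞]`. -/
noncomputable def ind (P : Prop) : ℝ≥0∞ := open Classical in if P then 1 else 0

theorem ind_true {P : Prop} (h : P) : ind P = 1 := by simp [ind, h]

theorem ind_false {P : Prop} (h : ¬P) : ind P = 0 := by simp [ind, h]

theorem ind_le_one (P : Prop) : ind P ≤ 1 := by
  unfold ind; split_ifs <;> simp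

theorem ind_mono {P Q : Prop} (h : P → Q) : ind P ≤ ind Q := by
  by_cases hP : P
  · rw [ind_true hP, ind_true (h hP)]
  · rw [ind_false hP]; exact zero_le

theorem ind_sq (P : Prop) : ind P ^ 2 = ind P := by
  by_cases hP : P <;> simp [ind, hP]

section Expect

variable {α β : Type*}

theorem expect_pure (a : α) (f : α → ℝ≥0∞) : expect (PMF.pure a) f = f a := by
  classical
  unfold expect
  rw [tsum_eq_single a]
  · simp
  · intro b hb; simp [hb]

theorem expect_bind (p : PMF α) (k : α → PMF β) (f : β → ℝ≥0∞) :
    expect (p.bind k) f = expect p (fun a => expect (k a) f) := by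
  unfold expect
  simp only [PMF.bind_apply, ← ENNReal.tsum_mul_right, ← ENNReal.tsum_mul_left]
  rw [ENNReal.tsum_comm]
  simp only [mul_assoc]

theorem expect_map (p : PMF α) (h : α → β) (f : β → ℝ≥0∞) :
    expect (p.map h) f = expect p (fun a => f (h a)) := by
  rw [← PMF.bind_pure_comp, expect_bind]
  simp [expect_pure]

theorem expect_mono (p : PMF α) {f g : α → ℝ≥0∞} (h : ∀ a, f a ≤ g a) :
    expect p f ≤ expect p g :=
  ENNReal.tsum_le_tsum fun a => by gcongr; exact h a

theorem expect_congr {p : PMF α} {f g : α → ℝ≥0∞} (h : ∀ a ∈ p.support, f a = g a) :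
    expect p f = expect p g := by
  unfold expect
  refine tsum_congr fun a => ?_
  by_cases ha : p a = 0
  · simp [ha]
  · rw [h a ((PMF.mem_support_iff _ _).2 ha)]

theorem expect_mono_support {p : PMF α} {f g : α → ℝ≥0∞} (h : ∀ a ∈ p.support, f a ≤ g a) :
    expect p f ≤ expect p g := by
  unfold expect
  refine ENNReal.tsum_le_tsum fun a => ?_
  by_cases ha : p a = 0
  · simp [ha]
  · gcongr; exact h a ((PMF.mem_support_iff _ _).2 ha)

theorem expect_const (p : PMF α) (c : ℝ≥0∞) : expect p (fun _ => c) = c := by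
  unfold expect; rw [ENNReal.tsum_mul_right, PMF.tsum_coe, one_mul]

theorem expect_add (p : PMF α) (f g : α → ℝ≥0∞) :
    expect p (fun a => f a + g a) = expect p f + expect p g := by
  unfold expect; simp only [mul_add]; rw [ENNReal.tsum_add]

theorem expect_const_mul (p : PMF α) (c : ℝ≥0∞) (f : α → ℝ≥0∞) :
    expect p (fun a => c * f a) = c * expect p f := by
  unfold expect; rw [← ENNReal.tsum_mul_left]
  exact tsum_congr fun a => by ring

theorem expect_sum {ι : Type*} (p : PMF α) (s : Finset ι) (f : ι → α → ℝ≥0∞) :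
    expect p (fun a => ∑ i ∈ s, f i a) = ∑ i ∈ s, expect p (f i) := by
  classical
  induction s using Finset.induction_on with
  | empty => simpa using expect_const p 0
  | insert i s hi ih => simp only [Finset.sum_insert hi, expect_add, ih]

theorem expect_comm (p : PMF α) (q : PMF β) (f : α → β → ℝ≥0∞) :
    expect p (fun a => expect q (f a)) = expect q (fun b => expect p (fun a => f a b)) := by
  unfold expect
  simp only [← ENNReal.tsum_mul_left]
  rw [ENNReal.tsum_comm]
  exact tsum_congr fun b => tsum_congr fun a => by ring

theorem two_mul_mul_le_sq_add_sq (x y : ℝ≥0∞) : 2 * (x * y) ≤ x ^ 2 + y ^ 2 := by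
  rcases eq_or_ne x ⊤ with rfl | hx
  · simp
  rcases eq_or_ne y ⊤ with rfl | hy
  · simp
  lift x to NNReal using hx
  lift y to NNReal using hy
  norm_cast
  have := two_mul_le_add_sq (x : ℝ) y
  rw [← NNReal.coe_le_coe]; push_cast; linarith

/-- Jensen's inequality for the square. -/
theorem expect_sq_le (p : PMF α) (f : α → ℝ≥0∞) :
    expect p f ^ 2 ≤ expect p (fun a => f a ^ 2) := by
  have h : expect p f ^ 2 = expect p (fun a => expect p (fun b => f a * f b)) := by
    simp only [expect_const_mul]
    rw [sq]
    conv_rhs => enter [2, a]; rw [mul_comm]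
    rw [expect_const_mul]
  have h2 : 2 * expect p f ^ 2 ≤ 2 * expect p (fun a => f a ^ 2) := by
    rw [h, ← expect_const_mul]
    simp only [← expect_const_mul]
    calc _ ≤ expect p (fun a => expect p (fun b => f a ^ 2 + f b ^ 2)) :=
          expect_mono _ fun a => expect_mono _ fun b => two_mul_mul_le_sq_add_sq _ _
      _ = _ := by
          simp only [expect_add, expect_const]
          rw [expect_const_mul, two_mul]
  exact (ENNReal.mul_le_mul_iff_right (by norm_num) (by norm_num)).1 h2

theorem toOuterMeasure_eq_expect (p : PMF α) (P : α → Prop) :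
    p.toOuterMeasure {a | P a} = expect p (fun a => ind (P a)) := by
  classical
  rw [PMF.toOuterMeasure_apply]
  unfold expect
  refine tsum_congr fun a => ?_
  by_cases h : P a <;> simp [ind, h, Set.indicator]

theorem expect_ind_add_not (p : PMF α) (P : α → Prop) :
    expect p (fun a => ind (P a)) + expect p (fun a => ind (¬P a)) = 1 := by
  rw [← expect_add]
  calc _ = expect p (fun _ => 1) := by
        congr 1; funext a; by_cases h : P a <;> simp [ind, h]
    _ = 1 := expect_const _ _

end Expect

/-! ### Expectation transformers of program statements -/

section WP

variable {X Upd : Type*} (A : DynAlg X Upd) (x : X) (u : Option Upd)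

/-- The weakest pre-expectation: the expectation of `f` at the memory after running `s` from `m`,
with the time ignored. -/
noncomputable def wp (s : Stmt) (f : Mem A.State → ℝ≥0∞) (m : Mem A.State) : ℝ≥0∞ :=
  expect (s.exec A x u m) (fun q => f q.1)

variable {A x u}

theorem wp_skip (f : Mem A.State → ℝ≥0∞) (m : Mem A.State) : wp A x u .skip f m = f m := by
  simp [wp, Stmt.exec, expect_pure]

theorem wp_setN (a e : NExpr) (f : Mem A.State → ℝ≥0∞) (m : Mem A.State) :
    wp A x u (.setN a e) f m
      = f { m with nat := Function.update m.nat (a.eval m.nat) (e.eval m.nat) } := by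
  simp [wp, Stmt.exec, expect_pure]

theorem wp_setR (a : NExpr) (e : RExpr) (f : Mem A.State → ℝ≥0∞) (m : Mem A.State) :
    wp A x u (.setR a e) f m
      = f { m with real := Function.update m.real (a.eval m.nat) (e.eval m.nat m.real) } := by
  simp [wp, Stmt.exec, expect_pure]

theorem wp_flip (a : NExpr) (f : Mem A.State → ℝ≥0∞) (m : Mem A.State) :
    wp A x u (.flip a) f m
      = 2⁻¹ * f { m with nat := Function.update m.nat (a.eval m.nat) 0 }
        + 2⁻¹ * f { m with nat := Function.update m.nat (a.eval m.nat) 1 } := by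
  simp only [wp, Stmt.exec, expect_map]
  refine (expect_map (PMF.uniformOfFintype (Fin 2)) Fin.val (fun b => f
    { m with nat := Function.update m.nat (a.eval m.nat) b })).trans ?_
  simp [expect, tsum_fintype, Fin.sum_univ_two]

theorem wp_seq (s t : Stmt) (f : Mem A.State → ℝ≥0∞) (m : Mem A.State) :
    wp A x u (.seq s t) f m = wp A x u s (wp A x u t f) m := by
  simp only [wp, Stmt.exec, expect_bind, expect_map]

theorem wp_ite (c : Test) (s t : Stmt) (f : Mem A.State → ℝ≥0∞) (m : Mem A.State) :
    wp A x u (.ite c s t) f m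
      = open Classical in if c.Holds m.nat m.real then wp A x u s f m else wp A x u t f m := by
  simp only [wp, Stmt.exec, expect_map]
  split_ifs <;> rfl

theorem expect_iterRun {M : Type*} (r : M → PMF (M × ℕ)) (n : ℕ) (f : M → ℝ≥0∞) (m : M) :
    expect (iterRun r n m) (fun q => f q.1)
      = (fun F m => expect (r m) (fun q => F q.1))^[n] f m := by
  induction n generalizing m with
  | zero => simp [iterRun, expect_pure]
  | succ n ih =>
    rw [Function.iterate_succ_apply']
    simp only [iterRun, expect_bind, expect_map, ih]

theorem wp_loop (n : NExpr) (b : Stmt) (f : Mem A.State → ℝ≥0∞) (m : Mem A.State) :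
    wp A x u (.loop n b) f m = (wp A x u b)^[n.eval m.nat] f m := by
  simp only [wp, Stmt.exec, expect_map]
  exact expect_iterRun _ _ f m

theorem wp_start (j : NExpr) (f : Mem A.State → ℝ≥0∞) (m : Mem A.State) :
    wp A x u (.start j) f m = expect A.seed (fun r =>
      f { m with slot := Function.update m.slot (j.eval m.nat) (some (A.init r x)) }) := by
  simp only [wp, Stmt.exec, expect_map]

theorem wp_ask_some (j a : NExpr) (f : Mem A.State → ℝ≥0∞) (m : Mem A.State)
    {s : A.State} (h : m.slot (j.eval m.nat) = some s) :
    wp A x u (.ask j a) f m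
      = f { m with real := Function.update m.real (a.eval m.nat) (A.query s) } := by
  simp only [wp, Stmt.exec, h, expect_pure]

theorem wp_ask_none (j a : NExpr) (f : Mem A.State → ℝ≥0∞) (m : Mem A.State)
    (h : m.slot (j.eval m.nat) = none) :
    wp A x u (.ask j a) f m = f m := by
  simp only [wp, Stmt.exec, h, expect_pure]

theorem wp_mono (s : Stmt) {f g : Mem A.State → ℝ≥0∞} (h : ∀ m, f m ≤ g m) (m : Mem A.State) :
    wp A x u s f m ≤ wp A x u s g m :=
  expect_mono _ fun q => h q.1

theorem wp_const (s : Stmt) (c : ℝ≥0∞) (m : Mem A.State) : wp A x u s (fun _ => c) m = c :=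
  expect_const _ _

theorem wp_add (s : Stmt) (f g : Mem A.State → ℝ≥0∞) (m : Mem A.State) :
    wp A x u s (fun m => f m + g m) m = wp A x u s f m + wp A x u s g m :=
  expect_add _ _ _

theorem wp_const_mul (s : Stmt) (c : ℝ≥0∞) (f : Mem A.State → ℝ≥0∞) (m : Mem A.State) :
    wp A x u s (fun m => c * f m) m = c * wp A x u s f m :=
  expect_const_mul _ _ _

/-! ### Failure probabilities of program statements -/

/-- A probabilistic Hoare triple: started in a memory with `P`, the statement `s` ends in a memory
without `Q` with probability at most `ε`. -/
def Triple (A : DynAlg X Upd) (x : X) (u : Option Upd) (P : Mem A.State → Prop) (s : Stmt)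
    (ε : ℝ≥0∞) (Q : Mem A.State → Prop) : Prop :=
  ∀ m, P m → wp A x u s (fun m' => ind (¬Q m')) m ≤ ε

theorem Triple.seq {P Q R : Mem A.State → Prop} {s t : Stmt} {ε ε' : ℝ≥0∞}
    (h : Triple A x u P s ε Q) (h' : Triple A x u Q t ε' R) :
    Triple A x u P (.seq s t) (ε + ε') R := by
  intro m hm
  rw [wp_seq]
  calc _ ≤ wp A x u s (fun m' => ind (¬Q m') + ε') m := by
        refine wp_mono _ (fun m' => ?_) m
        by_cases hq : Q m'
        · exact (h' m' hq).trans le_add_self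
        · rw [ind_true hq]
          refine le_trans ?_ le_self_add
          calc _ ≤ wp A x u t (fun _ => 1) m' := wp_mono _ (fun _ => ind_le_one _) _
            _ = 1 := wp_const _ _ _
    _ ≤ _ := by
        rw [wp_add, wp_const]; gcongr; exact h m hm

theorem Triple.weaken {P P' Q Q' : Mem A.State → Prop} {s : Stmt} {ε ε' : ℝ≥0∞}
    (h : Triple A x u P s ε Q) (hP : ∀ m, P' m → P m) (hε : ε ≤ ε') (hQ : ∀ m, Q m → Q' m) :
    Triple A x u P' s ε' Q' := fun m hm =>
  (wp_mono _ (fun m' => ind_mono fun h h' => h (hQ m' h')) m).trans ((h m (hP m hm)).trans hε)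

theorem Triple.skip {P Q : Mem A.State → Prop} (h : ∀ m, P m → Q m) :
    Triple A x u P .skip 0 Q := by
  intro m hm
  rw [wp_skip, ind_false (by simpa using h m hm)]

theorem Triple.setN {P Q : Mem A.State → Prop} {a e : NExpr}
    (h : ∀ m, P m → Q { m with nat := Function.update m.nat (a.eval m.nat) (e.eval m.nat) }) :
    Triple A x u P (.setN a e) 0 Q := by
  intro m hm
  rw [wp_setN, ind_false (by simpa using h m hm)]

theorem Triple.setR {P Q : Mem A.State → Prop} {a : NExpr} {e : RExpr}
    (h : ∀ m, P m → Q { m with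
      real := Function.update m.real (a.eval m.nat) (e.eval m.nat m.real) }) :
    Triple A x u P (.setR a e) 0 Q := by
  intro m hm
  rw [wp_setR, ind_false (by simpa using h m hm)]

theorem Triple.ite {P Q : Mem A.State → Prop} {c : Test} {s t : Stmt} {ε : ℝ≥0∞}
    (h : Triple A x u (fun m => P m ∧ c.Holds m.nat m.real) s ε Q)
    (h' : Triple A x u (fun m => P m ∧ ¬c.Holds m.nat m.real) t ε Q) :
    Triple A x u P (.ite c s t) ε Q := by
  intro m hm
  rw [wp_ite]
  split_ifs with hc
  · exact h m ⟨hm, hc⟩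
  · exact h' m ⟨hm, hc⟩

/-- The loop rule, with an invariant that is indexed by the number of completed rounds. -/
theorem Triple.loop {Q : ℕ → Mem A.State → Prop} {n : NExpr} {b : Stmt} {N : ℕ} {ε : ℝ≥0∞}
    {P : Mem A.State → Prop} (hP : ∀ m, P m → Q 0 m ∧ n.eval m.nat = N)
    (h : ∀ i < N, Triple A x u (Q i) b ε (Q (i + 1))) :
    Triple A x u P (.loop n b) (N * ε) (Q N) := by
  have key : ∀ j ≤ N, ∀ m, Q (N - j) m →
      (wp A x u b)^[j] (fun m' => ind (¬Q N m')) m ≤ j * ε := by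
    intro j
    induction j with
    | zero =>
      intro _ m hm
      rw [Function.iterate_zero_apply, ind_false (not_not.2 (by simpa using hm))]
      exact zero_le
    | succ j ih =>
      intro hj m hm
      rw [Function.iterate_succ_apply']
      have h1 := h (N - (j + 1)) (by omega) m hm
      rw [show N - (j + 1) + 1 = N - j by omega] at h1
      calc _ ≤ wp A x u b (fun m' => ind (¬Q (N - j) m') + j * ε) m := by
            refine wp_mono _ (fun m' => ?_) m
            by_cases hq : Q (N - j) m'
            · exact (ih (by omega) m' hq).trans le_add_self
            · rw [ind_true hq]
              refine le_trans ?_ le_self_add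
              have : ∀ (i : ℕ) (m : Mem A.State),
                  (wp A x u b)^[i] (fun m' => ind (¬Q N m')) m ≤ 1 := by
                intro i
                induction i with
                | zero => intro m; exact ind_le_one _
                | succ i ih =>
                  intro m
                  rw [Function.iterate_succ_apply']
                  exact (wp_mono _ ih m).trans (wp_const _ _ _).le
              exact this _ _
        _ ≤ _ := by
            rw [wp_add, wp_const]; push_cast; rw [add_mul, one_mul, add_comm]; gcongr
  intro m hm
  obtain ⟨h0, hn⟩ := hP m hm
  rw [wp_loop, hn]
  exact key N le_rfl m (by simpa using h0)

end WP

/-! ### The program -/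

/-- The integer memory cell `i`. -/
def ncell (i : ℕ) : NExpr := .get (.lit i)

/-- The real memory cell `i`. -/
def rcell (i : ℕ) : RExpr := .get (.lit i)

/-- Append a random bit to the binary expansion of cell `3`. -/
def drawBit : Stmt :=
  .seq (.flip (.lit 2))
    (.seq (.setN (.lit 3) (.add (.add (ncell 3) (ncell 3)) (ncell 2))) (.setN (.lit 2) (.lit 0)))

/-- Put into integer cell `2` a fair bit with probability `1/2`, and otherwise the truth value of
`θ < σ * z`, for the real cells `θ = 2`, `z = 1` and `σ = 4`. -/
def noisyBit : Stmt :=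
  .seq (.flip (.lit 2))
    (.ite (.ltN (ncell 2) (.lit 1)) (.flip (.lit 2))
      (.ite (.ltR (rcell 2) (.mul (rcell 4) (rcell 1)))
        (.setN (.lit 2) (.lit 1)) (.setN (.lit 2) (.lit 0))))

/-- Query a uniformly random copy among `2 ^ w` copies, and add to cell `4` the noisy bit that says
whether its answer `z` satisfies `θ < σ * z`. The index of the copy and its answer are erased at
the end, so that the bit is all that is learned about the copies. -/
def sample (w : ℕ) : Stmt :=
  .seq (.setN (.lit 3) (.lit 0)) (.seq (.setN (.lit 2) (.lit 0)) (.seq (.loop (.lit w) drawBit)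
    (.seq (.setR (.lit 1) (.lit 0)) (.seq (.ask (ncell 3) (.lit 1)) (.seq noisyBit
      (.seq (.setN (.lit 4) (.add (ncell 4) (ncell 2))) (.seq (.setN (.lit 2) (.lit 0))
        (.seq (.setN (.lit 3) (.lit 0)) (.setR (.lit 1) (.lit 0))))))))))

/-- Put into real cell `2` the threshold `v * b ^ 2 ^ (d - i)`, where `v` is real cell `3` and `i`
is integer cell `5`. -/
noncomputable def setThreshold (d : ℕ) (b : ℝ) : Stmt :=
  .seq (.setR (.lit 2) (.lit b))
    (.seq (.loop (.sub (.lit d) (ncell 5)) (.setR (.lit 2) (.mul (rcell 2) (rcell 2))))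
      (.setR (.lit 2) (.mul (rcell 3) (rcell 2))))

/-- Count the positive answers among `s` samples in integer cell `4`. -/
def countVotes (w s : ℕ) : Stmt :=
  .seq (.setN (.lit 4) (.lit 0)) (.loop (.lit s) (sample w))

/-- One level of the binary search: raise the lower bound `v` (real cell `3`) to the threshold if
the majority of the samples is above the threshold. -/
noncomputable def searchLevel (w s d : ℕ) (b : ℝ) : Stmt :=
  .seq (.setN (.lit 5) (.add (ncell 5) (.lit 1))) (.seq (setThreshold d b) (.seq (countVotes w s)
    (.ite (.ltN (.lit s) (.add (ncell 4) (ncell 4))) (.setR (.lit 3) (rcell 2)) .skip)))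

/-- A binary search over the thresholds `v₀ * b ^ j` with `j < 2 ^ d`, for answers with the sign
`σ` in real cell `4`, which is switched afterwards. The output is set if the search finds a
threshold above `v₀`. -/
noncomputable def signedSearch (w s d : ℕ) (b v₀ : ℝ) : Stmt :=
  .seq (.setR (.lit 3) (.lit v₀)) (.seq (.setN (.lit 5) (.lit 0))
    (.seq (.loop (.lit d) (searchLevel w s d b))
      (.seq (.ite (.ltR (.lit v₀) (rcell 3))
          (.setR (.lit 0) (.mul (rcell 4) (.mul (rcell 3) (.lit b)))) .skip)
        (.setR (.lit 4) (.sub (.lit 0) (rcell 4))))))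

/-- Compute the output from the answers of the copies: a search among the positive answers, and
one among the negative answers. -/
noncomputable def searchBoth (w s d : ℕ) (b v₀ : ℝ) : Stmt :=
  .seq (.setR (.lit 0) (.lit 0)) (.seq (.setR (.lit 4) (.lit 1))
    (.seq (signedSearch w s d b v₀) (signedSearch w s d b v₀)))

/-- Advance the counter of the rounds of a phase, which is integer cell `0`. -/
def advance (T : ℕ) : Stmt :=
  .seq (.setN (.lit 0) (.add (ncell 0) (.lit 1)))
    (.ite (.ltN (ncell 0) (.lit T)) .skip (.setN (.lit 0) (.lit 0)))

/-- Start a fresh copy in the slot given by cell `1`, and advance to the next slot. -/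
def startOne : Stmt :=
  .seq (.start (ncell 1)) (.setN (.lit 1) (.add (ncell 1) (.lit 1)))

/-- Feed the current update to the copy in the slot given by cell `1`, and advance to the next
slot. -/
def feedOne : Stmt :=
  .seq (.feed (ncell 1)) (.setN (.lit 1) (.add (ncell 1) (.lit 1)))

/-- Start `k` fresh copies. -/
def startAll (k : ℕ) : Stmt := .seq (.setN (.lit 1) (.lit 0)) (.loop (.lit k) startOne)

/-- Feed the current update to `k` copies. -/
def feedAll (k : ℕ) : Stmt := .seq (.setN (.lit 1) (.lit 0)) (.loop (.lit k) feedOne)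

/-- Output, then advance the counter. -/
noncomputable def respond (T w s d : ℕ) (b v₀ : ℝ) : Stmt :=
  .seq (searchBoth w s d b v₀) (advance T)

/-- The whole reduction: every phase of `T` rounds runs `2 ^ w` copies, which are started on the
input of the first round of the phase. -/
noncomputable def robustProgram (T w s d : ℕ) (b v₀ : ℝ) : Program where
  init := .skip
  step := .seq (.ite (.ltN (ncell 0) (.lit 1)) (startAll (2 ^ w)) (feedAll (2 ^ w)))
    (respond T w s d b v₀)

theorem robustProgram_size (T w s d : ℕ) (b v₀ : ℝ) :
    (robustProgram T w s d b v₀).size ≤ 1000 := by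
  simp [Program.size, robustProgram, Stmt.size, NExpr.size, RExpr.size, Test.size, startAll, startOne, feedOne,
    feedAll, respond, searchBoth, advance, signedSearch, searchLevel, setThreshold, countVotes, sample, noisyBit,
    drawBit, ncell, rcell]

/-! ### The law of a sample -/

section Sample

variable {X Upd : Type*} {A : DynAlg X Upd} {x : X} {u : Option Upd}

/-- The content of real cell `1` after it has been set to `0` and the copy in a slot has been
queried; an empty slot leaves the `0`. -/
def answer (A : DynAlg X Upd) (o : Option A.State) : ℝ := o.elim 0 A.query

theorem wp_ask (j : NExpr) (a : ℕ) (f : Mem A.State → ℝ≥0∞) (N : ℕ → ℕ) (R : ℕ → ℝ)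
    (σ : ℕ → Option A.State) (h : R a = 0) :
    wp A x u (.ask j (.lit a)) f ⟨N, R, σ⟩
      = f ⟨N, Function.update R a (answer A (σ (j.eval N))), σ⟩ := by
  rcases h' : σ (j.eval N) with _ | s
  · rw [wp_ask_none _ _ _ _ h']
    congr 2
    simp only [answer, Option.elim]
    rw [← h, Function.update_eq_self]
  · rw [wp_ask_some _ _ _ _ h']
    rfl

/-- The integer memory with index `a` in cell `3`, and cell `2` cleared. -/
def withIndex (N : ℕ → ℕ) (a : ℕ) : ℕ → ℕ := Function.update (Function.update N 3 a) 2 0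

theorem wp_drawBits (w : ℕ) (f : Mem A.State → ℝ≥0∞) (N : ℕ → ℕ) (R : ℕ → ℝ)
    (σ : ℕ → Option A.State) (a : ℕ) :
    (wp A x u drawBit)^[w] f ⟨withIndex N a, R, σ⟩
      = (2 ^ w : ℝ≥0∞)⁻¹ * ∑ i ∈ Finset.range (2 ^ w), f ⟨withIndex N (a * 2 ^ w + i), R, σ⟩ := by
  induction w generalizing a with
  | zero => simp
  | succ w ih =>
    have e (b : ℕ) : Function.update (Function.update (Function.update (withIndex N a) 2 b) 3
        (a + a + b)) 2 0 = withIndex N (a + a + b) := by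
      funext i
      simp only [withIndex, Function.update_apply]
      split_ifs <;> simp_all
    have e3 (b : ℕ) : (Function.update (withIndex N a) 2 b) 3 = a := by
      simp [withIndex]
    rw [Function.iterate_succ_apply']
    simp only [drawBit, wp_seq, wp_flip, wp_setN, NExpr.eval, ncell, e3, Function.update_self, e]
    change 2⁻¹ * (wp A x u drawBit)^[w] f _ + 2⁻¹ * (wp A x u drawBit)^[w] f _ = _
    rw [ih, ih, pow_succ, pow_succ, Nat.mul_two (2 ^ w), Finset.sum_range_add,
      ENNReal.mul_inv (by simp) (by simp), mul_comm _ (2⁻¹ : ℝ≥0∞), mul_assoc,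
      ← mul_add, ← mul_add]
    congr 3
    · refine Finset.sum_congr rfl fun i _ => ?_
      congr 3; ring
    · refine Finset.sum_congr rfl fun i _ => ?_
      congr 3; ring

/-- The integer memory after a sample that contributes the bit `b`. -/
def withVote (N : ℕ → ℕ) (b : ℕ) : ℕ → ℕ :=
  Function.update (Function.update (Function.update N 2 0) 3 0) 4 (N 4 + b)

open Classical in
/-- The number of slots among the first `k` whose answers `z` satisfy `θ < s * z`. -/
noncomputable def hits (A : DynAlg X Upd) (σ : ℕ → Option A.State) (k : ℕ) (θ s : ℝ) : ℕ :=
  ((Finset.range k).filter fun j => θ < s * answer A (σ j)).card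

theorem hits_le (σ : ℕ → Option A.State) (k : ℕ) (θ s : ℝ) : hits A σ k θ s ≤ k := by
  classical
  exact (Finset.card_filter_le _ _).trans (by simp)

/-- The probability that a sample contributes a `1`. -/
noncomputable def voteProb (A : DynAlg X Upd) (σ : ℕ → Option A.State) (w : ℕ) (θ s : ℝ) : ℝ :=
  1 / 4 + hits A σ (2 ^ w) θ s / 2 ^ w / 2

theorem voteProb_mem (σ : ℕ → Option A.State) (w : ℕ) (θ s : ℝ) :
    1 / 4 ≤ voteProb A σ w θ s ∧ voteProb A σ w θ s ≤ 3 / 4 := by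
  have h : (hits A σ (2 ^ w) θ s : ℝ) / 2 ^ w ≤ 1 := by
    rw [div_le_one (by positivity)]
    exact_mod_cast hits_le σ (2 ^ w) θ s
  have h' : (0 : ℝ) ≤ (hits A σ (2 ^ w) θ s : ℝ) / 2 ^ w := by positivity
  unfold voteProb
  constructor <;> linarith

open Classical in
theorem wp_noisyBit (f : Mem A.State → ℝ≥0∞) (N : ℕ → ℕ) (R : ℕ → ℝ) (σ : ℕ → Option A.State) :
    wp A x u noisyBit f ⟨N, R, σ⟩
      = 2⁻¹ * (2⁻¹ * f ⟨Function.update N 2 0, R, σ⟩ + 2⁻¹ * f ⟨Function.update N 2 1, R, σ⟩)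
        + 2⁻¹ * f ⟨Function.update N 2 (if R 2 < R 4 * R 1 then 1 else 0), R, σ⟩ := by
  simp only [noisyBit, wp_seq, wp_flip, wp_ite, wp_setN, Test.Holds, NExpr.eval, RExpr.eval,
    ncell, rcell, Function.update_self, Function.update_idem, zero_lt_one, lt_irrefl, if_true,
    if_false]
  split_ifs <;> rfl

theorem wp_sample (w : ℕ) (f : Mem A.State → ℝ≥0∞) (N : ℕ → ℕ) (R : ℕ → ℝ)
    (σ : ℕ → Option A.State) :
    wp A x u (sample w) f ⟨N, R, σ⟩
      = ENNReal.ofReal (1 - voteProb A σ w (R 2) (R 4))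
          * f ⟨withVote N 0, Function.update R 1 0, σ⟩
        + ENNReal.ofReal (voteProb A σ w (R 2) (R 4))
          * f ⟨withVote N 1, Function.update R 1 0, σ⟩ := by
  classical
  have e0 : Function.update (Function.update N 3 0) 2 0 = withIndex N 0 := rfl
  have e4 (a b : ℕ) : Function.update (Function.update (Function.update
      (Function.update (withIndex N a) 2 b) 4 (N 4 + b)) 2 0) 3 0 = withVote N b := by
    funext i
    simp only [withIndex, withVote, Function.update_apply]
    split_ifs <;> simp_all
  have e3 (a : ℕ) : withIndex N a 3 = a := by simp [withIndex]
  have e5 (a b : ℕ) : (Function.update (withIndex N a) 2 b) 4 = N 4 := by simp [withIndex]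
  have er1 (c : ℝ) : Function.update (Function.update R 1 c) 1 0 = Function.update R 1 0 := by
    simp
  have er2 (c : ℝ) : (Function.update R 1 c) 2 = R 2 := by simp
  have er4 (c : ℝ) : (Function.update R 1 c) 4 = R 4 := by simp
  simp only [sample, wp_seq, wp_setN, wp_loop, NExpr.eval, e0, wp_drawBits, wp_setR, RExpr.eval,
    zero_mul, zero_add]
  simp only [wp_ask _ _ _ _ _ _ (Function.update_self (1 : ℕ) (0 : ℝ) R), NExpr.eval, ncell,
    wp_seq, wp_setN, wp_setR, RExpr.eval, Function.update_idem, wp_noisyBit, e3, e5, e4, er1, er2, er4, Function.update_self]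
  set F0 := f ⟨withVote N 0, Function.update R 1 0, σ⟩
  set F1 := f ⟨withVote N 1, Function.update R 1 0, σ⟩
  set h := hits A σ (2 ^ w) (R 2) (R 4) with hh
  have hsplit : ∑ j ∈ Finset.range (2 ^ w), f ⟨withVote N
      (if R 2 < R 4 * answer A (σ j) then 1 else 0), Function.update R 1 0, σ⟩
      = h * F1 + ((2 ^ w - h : ℕ) : ℝ≥0∞) * F0 := by
    rw [← Finset.sum_filter_add_sum_filter_not _ (fun j => R 2 < R 4 * answer A (σ j))]
    congr 1
    · rw [Finset.sum_congr rfl (g := fun _ => F1)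
        (fun j hj => by rw [if_pos (Finset.mem_filter.1 hj).2]), Finset.sum_const, nsmul_eq_mul]
      rfl
    · rw [Finset.sum_congr rfl (g := fun _ => F0)
        (fun j hj => by rw [if_neg (Finset.mem_filter.1 hj).2]), Finset.sum_const, nsmul_eq_mul]
      congr 2
      have := Finset.card_filter_add_card_filter_not (s := Finset.range (2 ^ w))
        (fun j => R 2 < R 4 * answer A (σ j))
      rw [Finset.card_range] at this
      simp only [hh, hits]
      omega
  have hle : h ≤ 2 ^ w := hits_le _ _ _ _
  rw [Finset.sum_add_distrib, Finset.sum_const, Finset.card_range, ← Finset.mul_sum, hsplit,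
    nsmul_eq_mul]
  have c0 : ENNReal.ofReal (1 - voteProb A σ w (R 2) (R 4))
      = 2⁻¹ * 2⁻¹ + (2 ^ w : ℝ≥0∞)⁻¹ * (2⁻¹ * ((2 ^ w - h : ℕ) : ℝ≥0∞)) := by
    have : (1 : ℝ) - voteProb A σ w (R 2) (R 4)
        = 2⁻¹ * 2⁻¹ + (2 ^ w : ℝ)⁻¹ * (2⁻¹ * ((2 ^ w - h : ℕ) : ℝ)) := by
      rw [Nat.cast_sub hle, voteProb, ← hh]; push_cast; field_simp; ring
    rw [this, ENNReal.ofReal_add (by positivity) (by positivity), ENNReal.ofReal_mul (by positivity),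
      ENNReal.ofReal_mul (by positivity), ENNReal.ofReal_mul (by positivity),
      ENNReal.ofReal_inv_of_pos (by positivity), ENNReal.ofReal_inv_of_pos (by positivity),
      ENNReal.ofReal_pow (by positivity), ENNReal.ofReal_natCast, ENNReal.ofReal_ofNat]
  have c1 : ENNReal.ofReal (voteProb A σ w (R 2) (R 4))
      = 2⁻¹ * 2⁻¹ + (2 ^ w : ℝ≥0∞)⁻¹ * (2⁻¹ * (h : ℝ≥0∞)) := by
    have : voteProb A σ w (R 2) (R 4)
        = 2⁻¹ * 2⁻¹ + (2 ^ w : ℝ)⁻¹ * (2⁻¹ * (h : ℝ)) := by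
      rw [voteProb, ← hh]; field_simp; ring
    rw [this, ENNReal.ofReal_add (by positivity) (by positivity), ENNReal.ofReal_mul (by positivity),
      ENNReal.ofReal_mul (by positivity), ENNReal.ofReal_mul (by positivity),
      ENNReal.ofReal_inv_of_pos (by positivity), ENNReal.ofReal_inv_of_pos (by positivity),
      ENNReal.ofReal_pow (by positivity), ENNReal.ofReal_natCast, ENNReal.ofReal_ofNat]
  rw [c0, c1, mul_add, ← mul_assoc (2 ^ w : ℝ≥0∞)⁻¹ ((2 ^ w : ℕ) : ℝ≥0∞)]
  push_cast
  rw [ENNReal.inv_mul_cancel (by simp) (by simp)]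
  ring

end Sample

/-! ### Second-moment comparison of two slot memories -/

/-- Cauchy–Schwarz for one biased bit against another; the constant is one plus the
`χ²`-divergence of the two bits. -/
theorem two_point_sq_le {p q ε : ℝ} (hp : 1 / 4 ≤ p ∧ p ≤ 3 / 4) (hq : 1 / 4 ≤ q ∧ q ≤ 3 / 4)
    (h : (p - q) ^ 2 * (16 / 3) ≤ ε) (x y : ℝ≥0∞) :
    (ENNReal.ofReal (1 - p) * x + ENNReal.ofReal p * y) ^ 2
      ≤ ENNReal.ofReal (1 + ε) * (ENNReal.ofReal (1 - q) * x ^ 2 + ENNReal.ofReal q * y ^ 2) := by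
  have hε : 0 ≤ ε := le_trans (by positivity) h
  have h1 : ENNReal.ofReal (1 + ε) ≠ 0 := by simp; linarith
  have h2 : ENNReal.ofReal (1 - q) ≠ 0 := by simp; linarith
  have h3 : ENNReal.ofReal q ≠ 0 := by simp; linarith
  rcases eq_or_ne x ⊤ with rfl | hx
  · simp [ENNReal.mul_top, h1, h2]
  rcases eq_or_ne y ⊤ with rfl | hy
  · simp [ENNReal.mul_top, h1, h3]
  obtain ⟨x, hx0, rfl⟩ : ∃ r : ℝ, 0 ≤ r ∧ x = ENNReal.ofReal r :=
    ⟨x.toReal, ENNReal.toReal_nonneg, (ENNReal.ofReal_toReal hx).symm⟩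
  obtain ⟨y, hy0, rfl⟩ : ∃ r : ℝ, 0 ≤ r ∧ y = ENNReal.ofReal r :=
    ⟨y.toReal, ENNReal.toReal_nonneg, (ENNReal.ofReal_toReal hy).symm⟩
  have e1 : 0 ≤ 1 - p := by linarith
  have e2 : 0 ≤ 1 - q := by linarith
  have e3 : 0 ≤ p := by linarith
  have e4 : 0 ≤ q := by linarith
  rw [← ENNReal.ofReal_mul e1, ← ENNReal.ofReal_mul e3, ← ENNReal.ofReal_add (by positivity)
    (by positivity), ← ENNReal.ofReal_pow (by positivity), ← ENNReal.ofReal_pow hx0,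
    ← ENNReal.ofReal_pow hy0, ← ENNReal.ofReal_mul e2, ← ENNReal.ofReal_mul e4,
    ← ENNReal.ofReal_add (by positivity) (by positivity), ← ENNReal.ofReal_mul (by positivity)]
  refine ENNReal.ofReal_le_ofReal ?_
  -- `1 + ε` bounds `(1 - p)² / (1 - q) + p² / q = 1 + (p - q)² / (q (1 - q))`.
  have hqq : 3 / 16 ≤ q * (1 - q) := by nlinarith [hq.1, hq.2]
  have hpos : 0 < q * (1 - q) := by linarith
  have hε' : (p - q) ^ 2 ≤ ε * (q * (1 - q)) := by nlinarith
  set S := (1 - q) * x ^ 2 + q * y ^ 2 with hS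
  have hS0 : 0 ≤ S := by positivity
  have key : (q * (1 - q)) * ((1 - p) * x + p * y) ^ 2
      ≤ (q * (1 - q) + (p - q) ^ 2) * S := by
    have : (q * (1 - q) + (p - q) ^ 2) * S - (q * (1 - q)) * ((1 - p) * x + p * y) ^ 2
        = ((1 - p) * q * y - p * (1 - q) * x) ^ 2 := by rw [hS]; ring
    nlinarith [sq_nonneg ((1 - p) * q * y - p * (1 - q) * x)]
  have : (q * (1 - q)) * ((1 - p) * x + p * y) ^ 2 ≤ (q * (1 - q)) * ((1 + ε) * S) := by
    refine key.trans ?_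
    have := mul_le_mul_of_nonneg_right hε' hS0
    nlinarith
  exact le_of_mul_le_mul_left this hpos

section SqBound

variable {X Upd : Type*} {A : DynAlg X Upd} {x : X} {u : Option Upd}
  {σ σ' : ℕ → Option A.State}

/-- Running `s` with the slots `σ` is comparable to running it with the slots `σ'`: in a form that
can be composed, `(E f)² ≤ c * E' (f²)` for functions `f` of the integer and real memories. -/
def SqBound (A : DynAlg X Upd) (x : X) (u : Option Upd) (σ σ' : ℕ → Option A.State) (c : ℝ≥0∞)
    (s : Stmt) : Prop :=
  ∀ f f' : Mem A.State → ℝ≥0∞, (∀ N R, f ⟨N, R, σ⟩ ^ 2 ≤ f' ⟨N, R, σ'⟩) →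
    ∀ N R, wp A x u s f ⟨N, R, σ⟩ ^ 2 ≤ c * wp A x u s f' ⟨N, R, σ'⟩

theorem SqBound.skip : SqBound A x u σ σ' 1 .skip := by
  intro f f' h N R; simpa [wp_skip] using h N R

theorem SqBound.setN (a e : NExpr) : SqBound A x u σ σ' 1 (.setN a e) := by
  intro f f' h N R; simpa [wp_setN] using h _ _

theorem SqBound.setR (a : NExpr) (e : RExpr) : SqBound A x u σ σ' 1 (.setR a e) := by
  intro f f' h N R; simpa [wp_setR] using h _ _

theorem SqBound.seq {s t : Stmt} {c c' : ℝ≥0∞} (hs : SqBound A x u σ σ' c s)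
    (ht : SqBound A x u σ σ' c' t) : SqBound A x u σ σ' (c * c') (.seq s t) := by
  intro f f' h N R
  rw [wp_seq, wp_seq, mul_assoc, ← wp_const_mul]
  exact hs _ _ (ht f f' h) N R

theorem SqBound.ite {s t : Stmt} {c : ℝ≥0∞} (b : Test) (hs : SqBound A x u σ σ' c s)
    (ht : SqBound A x u σ σ' c t) : SqBound A x u σ σ' c (.ite b s t) := by
  intro f f' h N R
  rw [wp_ite, wp_ite]
  dsimp only
  split_ifs
  · exact hs f f' h N R
  · exact ht f f' h N R

theorem SqBound.iterate {s : Stmt} {c : ℝ≥0∞} (hs : SqBound A x u σ σ' c s) (n : ℕ)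
    (f f' : Mem A.State → ℝ≥0∞) (h : ∀ N R, f ⟨N, R, σ⟩ ^ 2 ≤ f' ⟨N, R, σ'⟩) (N : ℕ → ℕ)
    (R : ℕ → ℝ) :
    (wp A x u s)^[n] f ⟨N, R, σ⟩ ^ 2 ≤ c ^ n * (wp A x u s)^[n] f' ⟨N, R, σ'⟩ := by
  induction n generalizing N R with
  | zero => simpa using h N R
  | succ n ih =>
    rw [Function.iterate_succ_apply', Function.iterate_succ_apply', pow_succ' c, mul_assoc,
      ← wp_const_mul]
    exact hs _ _ ih N R

theorem SqBound.loop {s : Stmt} {c : ℝ≥0∞} (hs : SqBound A x u σ σ' c s) (n : ℕ) :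
    SqBound A x u σ σ' (c ^ n) (.loop (.lit n) s) := by
  intro f f' h N R
  rw [wp_loop, wp_loop]
  exact hs.iterate n f f' h N R

theorem SqBound.loop_one {s : Stmt} (hs : SqBound A x u σ σ' 1 s) (n : NExpr) :
    SqBound A x u σ σ' 1 (.loop n s) := by
  intro f f' h N R
  rw [wp_loop, wp_loop]
  simpa using hs.iterate (n.eval N) f f' h N R

open Classical in
theorem hits_sub_le (S : Finset ℕ) (h : ∀ j ∉ S, σ j = σ' j) (k : ℕ) (θ s : ℝ) :
    hits A σ k θ s ≤ hits A σ' k θ s + S.card := by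
  refine le_trans (Finset.card_le_card ?_) (Finset.card_union_le _ _)
  intro j hj
  by_cases hS : j ∈ S
  · exact Finset.mem_union_right _ hS
  · refine Finset.mem_union_left _ ?_
    simpa [h j hS] using hj

/-- A sample is little affected by a change of few slots. -/
theorem SqBound.sample (w : ℕ) (S : Finset ℕ) (h : ∀ j ∉ S, σ j = σ' j) :
    SqBound A x u σ σ' (ENNReal.ofReal (1 + 4 / 3 * (S.card / 2 ^ w) ^ 2)) (sample w) := by
  intro f f' hf N R
  rw [wp_sample, wp_sample]
  set p := voteProb A σ w (R 2) (R 4) with hp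
  set q := voteProb A σ' w (R 2) (R 4) with hq
  have h1 : (hits A σ (2 ^ w) (R 2) (R 4) : ℝ) ≤ hits A σ' (2 ^ w) (R 2) (R 4) + S.card := by
    exact_mod_cast hits_sub_le S h _ _ _
  have h2 : (hits A σ' (2 ^ w) (R 2) (R 4) : ℝ) ≤ hits A σ (2 ^ w) (R 2) (R 4) + S.card := by
    exact_mod_cast hits_sub_le S (fun j hj => (h j hj).symm) _ _ _
  have hd : (p - q) ^ 2 ≤ (S.card / 2 ^ w / 2) ^ 2 := by
    have e : p - q = ((hits A σ (2 ^ w) (R 2) (R 4) : ℝ) - hits A σ' (2 ^ w) (R 2) (R 4))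
        / 2 ^ w / 2 := by rw [hp, hq, voteProb, voteProb]; ring
    rw [e]
    refine sq_le_sq' ?_ ?_
    · rw [← neg_div, ← neg_div]; gcongr; linarith
    · gcongr; linarith
  refine (two_point_sq_le (voteProb_mem _ _ _ _) (voteProb_mem _ _ _ _) (?_ :
    (p - q) ^ 2 * (16 / 3) ≤ 4 / 3 * (S.card / 2 ^ w : ℝ) ^ 2) _ _).trans ?_
  · nlinarith
  · gcongr
    · exact hf _ _
    · exact hf _ _

/-- The comparison for a whole round, which takes `2 * d * s` samples. -/
theorem SqBound.respond {c : ℝ≥0∞} {w : ℕ} (h : SqBound A x u σ σ' c (_root_.sample w))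
    (T s d : ℕ) (b v₀ : ℝ) :
    SqBound A x u σ σ' (c ^ (2 * d * s)) (_root_.respond T w s d b v₀) := by
  have hth : SqBound A x u σ σ' 1 (setThreshold d b) := by
    simpa [setThreshold] using (SqBound.setR _ _).seq
      (((SqBound.setR (σ := σ) (σ' := σ') _ _).loop_one _).seq (SqBound.setR _ _))
  have hcv : SqBound A x u σ σ' (c ^ s) (countVotes w s) := by
    simpa [countVotes] using (SqBound.setN _ _).seq (h.loop s)
  have hl : SqBound A x u σ σ' (c ^ s) (searchLevel w s d b) := by
    simpa [searchLevel] using (SqBound.setN _ _).seq (hth.seq (hcv.seq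
      (SqBound.ite _ (SqBound.setR _ _) SqBound.skip)))
  have hs : SqBound A x u σ σ' (c ^ (s * d)) (signedSearch w s d b v₀) := by
    simpa [signedSearch, pow_mul] using (SqBound.setR _ _).seq ((SqBound.setN _ _).seq ((hl.loop d).seq
      ((SqBound.ite _ (SqBound.setR _ _) SqBound.skip).seq (SqBound.setR _ _))))
  have hb : SqBound A x u σ σ' (c ^ (s * d) * c ^ (s * d)) (searchBoth w s d b v₀) := by
    simpa [searchBoth] using (SqBound.setR _ _).seq ((SqBound.setR _ _).seq (hs.seq hs))
  have ha : SqBound A x u σ σ' 1 (advance T) := by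
    simpa [advance] using (SqBound.setN _ _).seq (SqBound.ite _ SqBound.skip (SqBound.setN _ _))
  have := hb.seq ha
  rwa [mul_one, ← pow_add, show s * d + s * d = 2 * d * s by ring] at this

end SqBound

/-! ### Correctness of the majority votes -/

section Votes

variable {X Upd : Type*} {A : DynAlg X Upd} {x : X} {u : Option Upd} {σ : ℕ → Option A.State}

/-- The moment generating function of the votes, evaluated at `lam`. -/
theorem iterate_wp_sample_le (w n : ℕ) (f : Mem A.State → ℝ≥0∞) (B lam : ℝ≥0∞) (N : ℕ → ℕ)
    (R : ℕ → ℝ)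
    (hf : ∀ N' R', (∀ i, i ≠ 2 → i ≠ 3 → i ≠ 4 → N' i = N i) → (∀ i, i ≠ 1 → R' i = R i) →
      f ⟨N', R', σ⟩ ≤ B * lam ^ N' 4) (N' : ℕ → ℕ) (R' : ℕ → ℝ)
    (hN : ∀ i, i ≠ 2 → i ≠ 3 → i ≠ 4 → N' i = N i) (hR : ∀ i, i ≠ 1 → R' i = R i) :
    (wp A x u (sample w))^[n] f ⟨N', R', σ⟩
      ≤ B * (ENNReal.ofReal (1 - voteProb A σ w (R 2) (R 4))
        + ENNReal.ofReal (voteProb A σ w (R 2) (R 4)) * lam) ^ n * lam ^ N' 4 := by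
  induction n generalizing N' R' with
  | zero => simpa using hf N' R' hN hR
  | succ n ih =>
    have hv (b : ℕ) : ∀ i, i ≠ 2 → i ≠ 3 → i ≠ 4 → withVote N' b i = N i := by
      intro i h2 h3 h4
      simp [withVote, h2, h3, h4, hN]
    have hr : ∀ i, i ≠ 1 → Function.update R' 1 0 i = R i := by
      intro i h1; simp [h1, hR]
    have h4 (b : ℕ) : withVote N' b 4 = N' 4 + b := by simp [withVote]
    rw [Function.iterate_succ_apply', wp_sample, hR 2 (by simp), hR 4 (by simp)]
    refine (add_le_add (mul_le_mul_right (ih _ _ (hv 0) hr) _)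
      (mul_le_mul_right (ih _ _ (hv 1) hr) _)).trans (le_of_eq ?_)
    rw [h4, h4]
    ring

open Classical in
/-- If at most two fifths of the copies fail to satisfy `Acc`, then a majority of votes for `θ < s z`
shows that some value with `Acc` satisfies `θ < s z`, and a majority against it shows that some
value with `Acc` satisfies `s z ≤ θ`. The failure probability is Chernoff's bound. -/
theorem countVotes_triple (w n : ℕ) (Acc : ℝ → Prop)
    (hgood : 5 * ((Finset.range (2 ^ w)).filter fun j => ¬Acc (answer A (σ j))).card < 2 * 2 ^ w)
    (N : ℕ → ℕ) (R : ℕ → ℝ) :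
    Triple A x u (fun m => m = ⟨N, R, σ⟩) (countVotes w n) (ENNReal.ofReal (199 / 200) ^ n)
      (fun m => m.slot = σ ∧ m.nat 5 = N 5 ∧ m.nat 0 = N 0 ∧ (∀ i, i ≠ 1 → m.real i = R i) ∧
        (n < m.nat 4 + m.nat 4 → ∃ z, Acc z ∧ R 2 < R 4 * z) ∧
        (¬n < m.nat 4 + m.nat 4 → ∃ z, Acc z ∧ R 4 * z ≤ R 2)) := by
  rintro _ rfl
  rw [countVotes, wp_seq, wp_setN, wp_loop]
  simp only [NExpr.eval]
  set p := voteProb A σ w (R 2) (R 4) with hp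
  obtain ⟨hp1, hp3⟩ := voteProb_mem (A := A) σ w (R 2) (R 4)
  rw [← hp] at hp1 hp3
  set bad := ((Finset.range (2 ^ w)).filter fun j => ¬Acc (answer A (σ j))) with hbad
  have hbr : (5 : ℝ) * bad.card < 2 * 2 ^ w := by exact_mod_cast hgood
  have hk : (0 : ℝ) < 2 ^ w := by positivity
  obtain ⟨z₀, hz₀⟩ : ∃ z, Acc z := by
    by_contra hno
    push Not at hno
    have : bad = Finset.range (2 ^ w) := Finset.filter_true_of_mem fun j _ => hno _
    rw [this, Finset.card_range] at hgood
    omega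
  -- A bound `B * lam ^ c` for the failure after `c` votes suffices.
  have main (B lam : ℝ) (hB : 0 ≤ B) (hl : 0 ≤ lam)
      (hend : B ^ n * ((1 - p) + p * lam) ^ n ≤ (199 / 200) ^ n)
      (hf : ∀ c : ℕ, ind (¬((n < c + c → ∃ z, Acc z ∧ R 2 < R 4 * z) ∧
        (¬n < c + c → ∃ z, Acc z ∧ R 4 * z ≤ R 2))) ≤ ENNReal.ofReal (B ^ n * lam ^ c)) :
      (wp A x u (sample w))^[n] (fun m => ind (¬(m.slot = σ ∧ m.nat 5 = N 5 ∧ m.nat 0 = N 0 ∧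
        (∀ i, i ≠ 1 → m.real i = R i) ∧
        (n < m.nat 4 + m.nat 4 → ∃ z, Acc z ∧ R 2 < R 4 * z) ∧
        (¬n < m.nat 4 + m.nat 4 → ∃ z, Acc z ∧ R 4 * z ≤ R 2))))
        ⟨Function.update N 4 0, R, σ⟩ ≤ ENNReal.ofReal (199 / 200) ^ n := by
    refine (iterate_wp_sample_le w n _ (ENNReal.ofReal (B ^ n)) (ENNReal.ofReal lam) N R ?_ _ R
      (fun i _ _ h4 => by simp [h4]) (fun _ _ => rfl)).trans ?_
    · intro N' R' hN' hR'
      rw [← ENNReal.ofReal_pow hl, ← ENNReal.ofReal_mul (by positivity)]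
      refine le_trans (ind_mono ?_) (hf (N' 4))
      intro h hc
      exact h ⟨rfl, hN' 5 (by simp) (by simp) (by simp), hN' 0 (by simp) (by simp) (by simp), hR',
        hc⟩
    · rw [← hp, Function.update_self, pow_zero, mul_one, ← ENNReal.ofReal_mul (by linarith),
        ← ENNReal.ofReal_add (by linarith) (mul_nonneg (by linarith) hl), ← ENNReal.ofReal_pow
        (add_nonneg (by linarith) (mul_nonneg (by linarith) hl)), ← ENNReal.ofReal_mul
        (by positivity), ← ENNReal.ofReal_pow (by norm_num)]
      exact ENNReal.ofReal_le_ofReal hend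
  by_cases hA : ∃ z, Acc z ∧ R 2 < R 4 * z
  · by_cases hB : ∃ z, Acc z ∧ R 4 * z ≤ R 2
    · refine main 0 0 le_rfl le_rfl ?_ fun c => ?_
      · rw [← mul_pow]; gcongr
        · simp
        · norm_num
      · rw [ind_false (by simp only [hA, hB]; tauto)]; exact zero_le
    · -- Only misses of inaccurate copies count against the truth, so `p ≥ 11 / 20`.
      push Not at hB
      have hcard : 2 ^ w ≤ hits A σ (2 ^ w) (R 2) (R 4) + bad.card := by
        refine (Finset.card_range (2 ^ w)).ge.trans
          (le_trans (Finset.card_le_card ?_) (Finset.card_union_le _ _))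
        intro j hj
        by_cases hj' : Acc (answer A (σ j))
        · exact Finset.mem_union_left _ (Finset.mem_filter.2 ⟨hj, hB _ hj'⟩)
        · exact Finset.mem_union_right _ (Finset.mem_filter.2 ⟨hj, hj'⟩)
      have hcr : (2 : ℝ) ^ w ≤ hits A σ (2 ^ w) (R 2) (R 4) + bad.card := by exact_mod_cast hcard
      have hpp : 11 / 20 ≤ p := by
        have : 3 / 5 ≤ (hits A σ (2 ^ w) (R 2) (R 4) : ℝ) / 2 ^ w := by
          rw [le_div_iff₀ hk]; linarith
        rw [hp, voteProb]; linarith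
      refine main (11 / 10) (100 / 121) (by norm_num) (by norm_num) ?_ fun c => ?_
      · rw [← mul_pow]
        refine pow_le_pow_left₀ (mul_nonneg (by norm_num) (by linarith)) ?_ n
        linarith
      · by_cases hc : n < c + c
        · rw [ind_false (by simp only [hA, hc]; tauto)]; exact zero_le
        · refine (ind_le_one _).trans ?_
          rw [← ENNReal.ofReal_one]
          refine ENNReal.ofReal_le_ofReal ?_
          have e : (100 / 121 : ℝ) ^ c = ((11 / 10) ^ (c + c))⁻¹ := by
            rw [← two_mul, pow_mul, ← inv_pow]; norm_num
          rw [e, ← div_eq_mul_inv, le_div_iff₀ (by positivity), one_mul]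
          exact pow_le_pow_right₀ (by norm_num) (by omega)
  · -- Only hits of inaccurate copies count against the truth, so `p ≤ 9 / 20`.
    push Not at hA
    have hB : ∃ z, Acc z ∧ R 4 * z ≤ R 2 := ⟨z₀, hz₀, hA _ hz₀⟩
    have hcard : hits A σ (2 ^ w) (R 2) (R 4) ≤ bad.card := by
      refine Finset.card_le_card fun j hj => ?_
      obtain ⟨hj1, hj2⟩ := Finset.mem_filter.1 hj
      exact Finset.mem_filter.2 ⟨hj1, fun h => absurd hj2 (not_lt.2 (hA _ h))⟩
    have hcr : (hits A σ (2 ^ w) (R 2) (R 4) : ℝ) ≤ bad.card := by exact_mod_cast hcard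
    have hpp : p ≤ 9 / 20 := by
      have : (hits A σ (2 ^ w) (R 2) (R 4) : ℝ) / 2 ^ w ≤ 2 / 5 := by
        rw [div_le_iff₀ hk]; linarith
      rw [hp, voteProb]; linarith
    refine main (10 / 11) (121 / 100) (by norm_num) (by norm_num) ?_ fun c => ?_
    · rw [← mul_pow]
      refine pow_le_pow_left₀ (mul_nonneg (by norm_num) (by linarith)) ?_ n
      linarith
    · by_cases hc : n < c + c
      · refine (ind_le_one _).trans ?_
        rw [← ENNReal.ofReal_one]
        refine ENNReal.ofReal_le_ofReal ?_
        have e : (10 / 11 : ℝ) ^ n = ((11 / 10) ^ n)⁻¹ := by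
          rw [← inv_pow]; norm_num
        have e' : (121 / 100 : ℝ) ^ c = (11 / 10) ^ (c + c) := by
          rw [← two_mul, pow_mul]; norm_num
        rw [e, e', mul_comm, ← div_eq_mul_inv, le_div_iff₀ (by positivity), one_mul]
        exact pow_le_pow_right₀ (by norm_num) (by omega)
      · rw [ind_false (by simp only [hB, hc]; tauto)]; exact zero_le

/-! ### Correctness of the binary search -/

theorem wp_setThreshold (d : ℕ) (b : ℝ) (f : Mem A.State → ℝ≥0∞) (N : ℕ → ℕ) (R : ℕ → ℝ) :
    wp A x u (setThreshold d b) f ⟨N, R, σ⟩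
      = f ⟨N, Function.update R 2 (R 3 * b ^ 2 ^ (d - N 5)), σ⟩ := by
  have key (n : ℕ) (y : ℝ) (f : Mem A.State → ℝ≥0∞) :
      (wp A x u (.setR (.lit 2) (.mul (rcell 2) (rcell 2))))^[n] f
        ⟨N, Function.update R 2 y, σ⟩ = f ⟨N, Function.update R 2 (y ^ 2 ^ n), σ⟩ := by
    induction n generalizing y with
    | zero => simp
    | succ n ih =>
      rw [Function.iterate_succ_apply', wp_setR]
      simp only [NExpr.eval, RExpr.eval, rcell, Function.update_self, Function.update_idem]
      refine (ih _).trans ?_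
      congr 3
      rw [← sq, ← pow_mul, ← pow_succ']
  simp only [setThreshold, wp_seq, wp_setR, wp_loop, NExpr.eval, RExpr.eval, ncell]
  rw [key]
  simp only [wp_setR, NExpr.eval, RExpr.eval, rcell, Function.update_self, Function.update_idem]
  congr 3

/-- The invariant of the binary search for the value `a`, with sign `t`, after `i` levels; `Po`
is the assertion about the output cell. The lower bound `v` is witnessed by a value with `Acc`
unless it is still the initial one. -/
def SearchInv (σ : ℕ → Option A.State) (Acc : ℝ → Prop) (Po : ℝ → Prop) (a t b v₀ : ℝ) (c d i : ℕ)
    (m : Mem A.State) : Prop :=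
  m.slot = σ ∧ m.nat 0 = c ∧ m.nat 5 = i ∧ m.real 4 = t ∧ Po (m.real 0) ∧
    (m.real 3 = v₀ ∨ v₀ < m.real 3 ∧ ∃ z, Acc z ∧ m.real 3 < t * z) ∧
    t * a ≤ m.real 3 * b ^ 2 ^ (d - i)

open Classical in
theorem searchLevel_triple (w n d i : ℕ) (hi : i < d) (Acc Po : ℝ → Prop) (a t b v₀ : ℝ) (c : ℕ)
    (hb : 1 < b) (hv : 0 < v₀) (hAcc : ∀ z, Acc z → 0 < t * a → t * a ≤ t * z)
    (hgood : 5 * ((Finset.range (2 ^ w)).filter fun j => ¬Acc (answer A (σ j))).card < 2 * 2 ^ w) :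
    Triple A x u (SearchInv σ Acc Po a t b v₀ c d i) (searchLevel w n d b)
      (ENNReal.ofReal (199 / 200) ^ n) (SearchInv σ Acc Po a t b v₀ c d (i + 1)) := by
  rintro ⟨N, R, σ₀⟩ ⟨h1, h0, h2, h3, h4, h5, h6⟩
  dsimp only at h1 h0 h2 h3 h4 h5 h6
  subst h1
  rw [searchLevel, wp_seq, wp_setN, wp_seq]
  simp only [NExpr.eval, ncell, h2]
  rw [wp_setThreshold, Function.update_self]
  set q := b ^ 2 ^ (d - (i + 1)) with hq
  have hq2 : b ^ 2 ^ (d - i) = q * q := by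
    rw [hq, ← pow_add, ← two_mul, ← pow_succ', show d - (i + 1) + 1 = d - i by omega]
  have hq1 : 1 < q := one_lt_pow₀ hb (by positivity)
  have h3pos : 0 < R 3 := by
    rcases h5 with h | ⟨h, -⟩
    · rw [h]; exact hv
    · exact hv.trans h
  refine le_trans ?_ (add_zero _).le
  refine ((countVotes_triple w n Acc hgood _ _).seq (ε' := 0) (Triple.ite (s := .setR (.lit 3)
    (rcell 2)) (t := .skip) (Triple.setR ?_) (Triple.skip ?_))) _ rfl
  · rintro ⟨N', R', σ'⟩ ⟨⟨k1, k2, k0, k3, k4, -⟩, k5⟩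
    simp only [Test.Holds, NExpr.eval] at k1 k2 k0 k3 k4 k5
    obtain ⟨z, hz, hz'⟩ := k4 k5
    have r2 := k3 2 (by simp)
    simp [h3] at r2 hz'
    have hlt : R 3 < R 3 * q := by nlinarith
    refine ⟨k1, ?_, ?_, ?_, ?_, ?_, ?_⟩
    · simpa [h0] using k0
    · simpa using k2
    · simpa [NExpr.eval, h3] using k3 4 (by simp)
    · simpa [NExpr.eval, k3 0 (by simp)] using h4
    · right
      simp only [NExpr.eval, RExpr.eval, rcell, Function.update_self, r2]
      refine ⟨?_, z, hz, hz'⟩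
      rcases h5 with h | ⟨h, -⟩ <;> linarith
    · simp only [NExpr.eval, RExpr.eval, rcell, Function.update_self, r2, ← hq]
      rw [hq2] at h6
      linarith
  · rintro ⟨N', R', σ'⟩ ⟨⟨k1, k2, k0, k3, -, k4⟩, k5⟩
    simp only [Test.Holds, NExpr.eval] at k1 k2 k0 k3 k4 k5
    obtain ⟨z, hz, hz'⟩ := k4 k5
    have r3 : R' 3 = R 3 := by simpa using k3 3 (by simp)
    simp [h3] at hz'
    refine ⟨k1, ?_, ?_, ?_, ?_, ?_, ?_⟩
    · simpa [h0] using k0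
    · simpa using k2
    · simpa [h3] using k3 4 (by simp)
    · simpa [k3 0 (by simp)] using h4
    · simpa [r3] using h5
    · simp only [r3, ← hq]
      rcases le_or_gt (t * a) 0 with h | h
      · exact h.trans (by positivity)
      · exact (hAcc z hz h).trans hz'

open Classical in
theorem signedSearch_triple (w n d : ℕ) (Acc Po : ℝ → Prop) (a t b v₀ : ℝ) (c : ℕ)
    (ht : t * t = 1) (hb : 1 < b) (hv : 0 < v₀) (hU : t * a ≤ v₀ * b ^ 2 ^ d)
    (hlow : 0 < t * a → v₀ * b < t * a)
    (hAcc : ∀ z, Acc z → 0 < t * a → t * a ≤ t * z) (hAcc' : ∀ z, Acc z → 0 < t * z → 0 < t * a)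
    (hgood : 5 * ((Finset.range (2 ^ w)).filter fun j => ¬Acc (answer A (σ j))).card < 2 * 2 ^ w) :
    Triple A x u (fun m => m.slot = σ ∧ m.nat 0 = c ∧ m.real 4 = t ∧ Po (m.real 0))
      (signedSearch w n d b v₀) (d * ENNReal.ofReal (199 / 200) ^ n)
      (fun m => m.slot = σ ∧ m.nat 0 = c ∧ m.real 4 = -t ∧
        (0 < t * a → t * a ≤ t * m.real 0 ∧ ∃ z, Acc z ∧ t * m.real 0 < t * z * b) ∧
        (t * a ≤ 0 → Po (m.real 0))) := by
  have hloop := Triple.loop (A := A) (x := x) (u := u) (n := .lit d)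
    (P := SearchInv σ Acc Po a t b v₀ c d 0) (fun m hm => ⟨hm, rfl⟩)
    (fun i hi => searchLevel_triple w n d i hi Acc Po a t b v₀ c hb hv hAcc hgood)
  have htail : Triple A x u (SearchInv σ Acc Po a t b v₀ c d d)
      (.seq (.ite (.ltR (.lit v₀) (rcell 3))
          (.setR (.lit 0) (.mul (rcell 4) (.mul (rcell 3) (.lit b)))) .skip)
        (.setR (.lit 4) (.sub (.lit 0) (rcell 4)))) (0 + 0)
      (fun m => m.slot = σ ∧ m.nat 0 = c ∧ m.real 4 = -t ∧
        (0 < t * a → t * a ≤ t * m.real 0 ∧ ∃ z, Acc z ∧ t * m.real 0 < t * z * b) ∧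
        (t * a ≤ 0 → Po (m.real 0))) := by
    refine Triple.seq (Q := fun m => m.slot = σ ∧ m.nat 0 = c ∧ m.real 4 = t ∧
        (0 < t * a → t * a ≤ t * m.real 0 ∧ ∃ z, Acc z ∧ t * m.real 0 < t * z * b) ∧
        (t * a ≤ 0 → Po (m.real 0))) (Triple.ite (Triple.setR ?_) (Triple.skip ?_))
        (Triple.setR ?_)
    · rintro ⟨N, R, σ₀⟩ ⟨⟨h1, h0, -, h3, h4, h5, h6⟩, h7⟩
      simp only [Test.Holds, RExpr.eval, NExpr.eval, rcell] at h1 h0 h3 h4 h5 h6 h7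
      obtain ⟨z, hz, hz'⟩ : ∃ z, Acc z ∧ R 3 < t * z := by
        rcases h5 with h | ⟨-, h⟩
        · exact absurd h7 (by rw [h]; exact lt_irrefl _)
        · exact h
      have hpos : 0 < t * a := hAcc' z hz ((hv.trans h7).trans hz')
      refine ⟨h1, h0, by simpa [NExpr.eval] using h3, fun _ => ?_, fun h => absurd hpos
        (not_lt.2 h)⟩
      simp only [RExpr.eval, NExpr.eval, rcell, Function.update_self, h3]
      rw [Nat.sub_self, pow_zero, pow_one] at h6
      have e : t * (t * (R 3 * b)) = R 3 * b := by rw [← mul_assoc, ht, one_mul]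
      rw [e]
      exact ⟨h6, z, hz, by nlinarith⟩
    · rintro ⟨N, R, σ₀⟩ ⟨⟨h1, h0, -, h3, h4, h5, h6⟩, h7⟩
      simp only [Test.Holds, RExpr.eval, NExpr.eval, rcell] at h1 h0 h3 h4 h5 h6 h7
      refine ⟨h1, h0, h3, fun h => ?_, fun _ => h4⟩
      rcases h5 with h5 | ⟨h5, -⟩
      · rw [Nat.sub_self, pow_zero, pow_one, h5] at h6
        exact absurd (hlow h) (not_lt.2 h6)
      · exact absurd h5 h7
    · rintro ⟨N, R, σ₀⟩ ⟨h1, h0, h3, h4, h5⟩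
      dsimp only at h1 h0 h3 h4 h5
      exact ⟨h1, h0, by simp [NExpr.eval, RExpr.eval, rcell, h3], by simpa [NExpr.eval] using h4,
        by simpa [NExpr.eval] using h5⟩
  refine ((Triple.setR (Q := fun m => m.slot = σ ∧ m.nat 0 = c ∧ m.real 4 = t ∧ Po (m.real 0) ∧
    m.real 3 = v₀) ?_).seq
    ((Triple.setN (Q := SearchInv σ Acc Po a t b v₀ c d 0) ?_).seq (hloop.seq htail))).weaken
    (fun _ h => h) (by simp) (fun _ h => h)
  · rintro ⟨N, R, σ₀⟩ ⟨h1, h0, h2, h3⟩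
    dsimp only at h1 h0 h2 h3
    exact ⟨h1, h0, by simpa [NExpr.eval] using h2, by simpa [NExpr.eval] using h3,
      by simp [NExpr.eval, RExpr.eval]⟩
  · rintro ⟨N, R, σ₀⟩ ⟨h1, h0, h2, h3, h4⟩
    dsimp only at h1 h0 h2 h3 h4
    exact ⟨h1, by simpa [NExpr.eval] using h0, by simp [NExpr.eval], h2, h3, Or.inl h4,
      by simpa [h4] using hU⟩

open Classical in
/-- If fewer than two fifths of the copies are inaccurate, then the output is accurate except with
the failure probability of `2 * d` votes. -/
theorem searchBoth_triple (w n d : ℕ) (γ a b U v₀ : ℝ) (c : ℕ) (hb : 1 < b) (hv : 0 < v₀)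
    (hU : U ≤ v₀ * b ^ 2 ^ d) (hlow : v₀ * b < 1 / U) (hU1 : 1 < U)
    (ha : a ∈ Set.Icc (-U) (-(1 / U)) ∪ {0} ∪ Set.Icc (1 / U) U)
    (hgood : 5 * ((Finset.range (2 ^ w)).filter
      fun j => ¬IsApprox γ a (answer A (σ j))).card < 2 * 2 ^ w) :
    Triple A x u (fun m => m.slot = σ ∧ m.nat 0 = c) (searchBoth w n d b v₀)
      (2 * d * ENNReal.ofReal (199 / 200) ^ n)
      (fun m => IsApprox (γ * b) a (m.real 0)) := by
  have hUi : 0 < 1 / U := by positivity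
  have haU : a ≤ U ∧ -a ≤ U := by
    rcases ha with (⟨h1, h2⟩ | rfl) | ⟨h1, h2⟩ <;> constructor <;> linarith
  have hpos : 0 < a → v₀ * b < a := by
    rcases ha with (⟨h1, h2⟩ | rfl) | ⟨h1, h2⟩ <;> intro h <;> linarith
  have hneg : 0 < -a → v₀ * b < -a := by
    rcases ha with (⟨h1, h2⟩ | rfl) | ⟨h1, h2⟩ <;> intro h <;> linarith
  let Po : ℝ → Prop := fun o =>
    (0 < a → a ≤ o ∧ ∃ z, IsApprox γ a z ∧ o < z * b) ∧ (a ≤ 0 → o = 0)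
  have t1 := signedSearch_triple (A := A) (x := x) (u := u) w n d (IsApprox γ a) (fun o => o = 0)
    a 1 b v₀ c (by norm_num) hb hv (by linarith) (by simpa using hpos)
    (fun z hz h => by simp only [one_mul] at h ⊢; exact (hz.1 h.le).1)
    (fun z hz h => by
      simp only [one_mul] at h ⊢
      by_contra hn
      rcases (not_lt.1 hn).lt_or_eq with h' | h'
      · linarith [(hz.2 h').2]
      · have := hz.1 h'.ge
        rw [h', mul_zero] at this
        linarith) hgood
  have t2 := signedSearch_triple (A := A) (x := x) (u := u) w n d (IsApprox γ a) Po
    a (-1) b v₀ c (by norm_num) hb hv (by linarith) (by simpa using hneg)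
    (fun z hz h => by
      have := (hz.2 (by linarith)).2
      linarith)
    (fun z hz h => by
      by_contra hn
      have := (hz.1 (by linarith)).1
      linarith) hgood
  refine ((Triple.setR (Q := fun m => m.slot = σ ∧ m.nat 0 = c ∧ m.real 0 = 0) ?_).seq
    ((Triple.setR (Q := fun m => m.slot = σ ∧ m.nat 0 = c ∧ m.real 4 = 1 ∧ m.real 0 = 0) ?_).seq
      ((t1.weaken (fun _ h => h) le_rfl ?_).seq t2))).weaken (fun _ h => h) ?_ ?_
  · rintro m ⟨h1, h0⟩
    exact ⟨h1, h0, by simp [NExpr.eval, RExpr.eval]⟩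
  · rintro m ⟨h1, h0, h2⟩
    exact ⟨h1, h0, by simp [NExpr.eval, RExpr.eval], by simpa [NExpr.eval] using h2⟩
  · rintro m ⟨h1, h0, h2, h3, h4⟩
    simp only [one_mul] at h3 h4
    exact ⟨h1, h0, h2, h3, h4⟩
  · rw [zero_add, zero_add, ← two_mul, mul_assoc]
  · rintro m ⟨-, -, -, h3, h4⟩
    refine ⟨fun h => ?_, fun h => ?_⟩
    · obtain ⟨p1, p2⟩ := h4 (by linarith)
      rcases h.lt_or_eq with h' | h'
      · obtain ⟨q1, z, hz, hz'⟩ := p1 h'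
        refine ⟨q1, ?_⟩
        have := (hz.1 h).2
        nlinarith
      · rw [p2 h'.ge, ← h']; simp
    · obtain ⟨q1, z, hz, hz'⟩ := h3 (by linarith)
      refine ⟨?_, by linarith⟩
      have := (hz.2 h).1
      nlinarith

end Votes

/-! ### Independent seeds -/

section Seeds

variable {X Upd : Type*}

/-- The law of `k` independent seeds, as the values at `0, …, k - 1` of a function on `ℕ` whose
other values are irrelevant. -/
noncomputable def seedsLaw (A : DynAlg X Upd) : ℕ → PMF (ℕ → A.Seed)
  | 0 => PMF.pure fun _ => A.seed.support_nonempty.some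
  | k + 1 => (seedsLaw A k).bind fun r => A.seed.map fun v => Function.update r k v

/-- Resampling one of the seeds does not change their law. -/
theorem expect_seedsLaw_resample (A : DynAlg X Upd) (k j : ℕ) (hj : j < k)
    (f : (ℕ → A.Seed) → ℝ≥0∞) :
    expect (seedsLaw A k) f
      = expect (seedsLaw A k) fun r => expect A.seed fun v => f (Function.update r j v) := by
  induction k generalizing f with
  | zero => omega
  | succ k ih =>
    simp only [seedsLaw, expect_bind, expect_map]
    rcases Nat.lt_succ_iff_lt_or_eq.1 hj with h | rfl
    · rw [ih h]
      congr 1; funext r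
      rw [expect_comm]
      congr 1; funext v
      congr 1; funext v'
      rw [Function.update_comm h.ne]
    · simp only [Function.update_idem, expect_const]

/-- The slots after the updates `us` from the input `x₁`, if exactly the slots in `D` hold copies,
with the seeds `r`. -/
def slotsOf (A : DynAlg X Upd) (D : Finset ℕ) (r : ℕ → A.Seed) (x₁ : X) (us : List Upd) :
    ℕ → Option A.State :=
  fun j => if j ∈ D then some (A.stateAfter (r j) x₁ us) else none

theorem slotsOf_congr (A : DynAlg X Upd) (D : Finset ℕ) {r r' : ℕ → A.Seed} (h : ∀ j ∈ D, r j = r' j)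
    (x₁ : X) (us : List Upd) : slotsOf A D r x₁ us = slotsOf A D r' x₁ us := by
  funext j
  unfold slotsOf
  split_ifs with hj
  · rw [h j hj]
  · rfl

end Seeds

/-! ### The transcript of a phase -/

/-- A position of the game inside a phase, after an update has been chosen and processed and before
the response to it. The slots are left out, as they are determined by the seeds and the updates.
`us` are the updates of the phase except the first one, which precedes the start of the copies. -/
structure PhasePos (X Upd : Type*) where
  us : List Upd
  rounds : List (Round X Upd)
  upd : Upd
  nat : ℕ → ℕ
  real : ℕ → ℝ

section Phase

variable {X Upd : Type*}

/-- One step of a phase, for fixed seeds: the response `st` to the current update, and the next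
update. Integer cell `1` is the loop counter of the feeding of the `k` copies. -/
noncomputable def phaseStep (A : DynAlg X Upd) (act : Upd → X → X) (adv : Adversary X Upd)
    (st : Stmt) (k : ℕ) (x₀ x₁ : X) (D : Finset ℕ) (r : ℕ → A.Seed) (q : PhasePos X Upd) :
    PMF (PhasePos X Upd) :=
  (st.exec A (inputAfter act x₁ q.us) (some q.upd)
    ⟨q.nat, q.real, slotsOf A D r x₁ q.us⟩).bind fun p =>
    (adv.next x₀ (q.rounds ++ [⟨q.upd, inputAfter act x₁ q.us, p.1.real 0⟩])).map fun v =>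
      ⟨q.us ++ [v], q.rounds ++ [⟨q.upd, inputAfter act x₁ q.us, p.1.real 0⟩], v,
        Function.update p.1.nat 1 k, p.1.real⟩

/-- The law of the position after `n` steps of a phase. -/
noncomputable def phaseLaw (A : DynAlg X Upd) (act : Upd → X → X) (adv : Adversary X Upd)
    (st : Stmt) (k : ℕ) (x₀ x₁ : X) (D : Finset ℕ) (r : ℕ → A.Seed) :
    ℕ → PhasePos X Upd → PMF (PhasePos X Upd)
  | 0, q => PMF.pure q
  | n + 1, q => (phaseStep A act adv st k x₀ x₁ D r q).bind
      (phaseLaw A act adv st k x₀ x₁ D r n)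

variable {A : DynAlg X Upd} {act : Upd → X → X} {adv : Adversary X Upd} {st : Stmt} {k : ℕ}
  {x₀ x₁ : X}

theorem expect_phaseStep (D : Finset ℕ) (r : ℕ → A.Seed) (q : PhasePos X Upd)
    (f : PhasePos X Upd → ℝ≥0∞) :
    expect (phaseStep A act adv st k x₀ x₁ D r q) f
      = wp A (inputAfter act x₁ q.us) (some q.upd) st (fun m =>
          expect (adv.next x₀ (q.rounds ++ [⟨q.upd, inputAfter act x₁ q.us, m.real 0⟩])) fun v =>
            f ⟨q.us ++ [v], q.rounds ++ [⟨q.upd, inputAfter act x₁ q.us, m.real 0⟩], v,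
              Function.update m.nat 1 k, m.real⟩) ⟨q.nat, q.real, slotsOf A D r x₁ q.us⟩ := by
  simp only [phaseStep, expect_bind, expect_map, wp]

theorem phaseLaw_length (D : Finset ℕ) (r : ℕ → A.Seed) (n : ℕ) (q q' : PhasePos X Upd)
    (h : q' ∈ (phaseLaw A act adv st k x₀ x₁ D r n q).support) :
    q'.us.length = q.us.length + n := by
  induction n generalizing q with
  | zero =>
    simp only [phaseLaw, PMF.support_pure, Set.mem_singleton_iff] at h
    simp [h]
  | succ n ih =>
    simp only [phaseLaw, PMF.mem_support_bind_iff] at h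
    obtain ⟨q₁, h₁, h₂⟩ := h
    rw [ih _ h₂]
    simp only [phaseStep, PMF.mem_support_bind_iff, PMF.mem_support_map_iff] at h₁
    obtain ⟨_, -, _, -, rfl⟩ := h₁
    simp; omega

theorem phaseLaw_congr (D : Finset ℕ) {r r' : ℕ → A.Seed} (h : ∀ j ∈ D, r j = r' j) (n : ℕ) :
    phaseLaw A act adv st k x₀ x₁ D r n = phaseLaw A act adv st k x₀ x₁ D r' n := by
  induction n with
  | zero => rfl
  | succ n ih =>
    funext q
    simp only [phaseLaw, phaseStep, ih, slotsOf_congr A D h]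

theorem phaseLaw_sq_le (D D' : Finset ℕ) (r : ℕ → A.Seed) {c : ℝ≥0∞}
    (hc : ∀ (us : List Upd) (v : Upd), SqBound A (inputAfter act x₁ us) (some v)
      (slotsOf A D r x₁ us) (slotsOf A D' r x₁ us) c st)
    (n : ℕ) (q : PhasePos X Upd) (f : PhasePos X Upd → ℝ≥0∞) :
    expect (phaseLaw A act adv st k x₀ x₁ D r n q) f ^ 2
      ≤ c ^ n * expect (phaseLaw A act adv st k x₀ x₁ D' r n q) (fun q => f q ^ 2) := by
  induction n generalizing q with
  | zero => simp [phaseLaw, expect_pure]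
  | succ n ih =>
    simp only [phaseLaw, expect_bind]
    rw [expect_phaseStep, expect_phaseStep]
    rw [pow_succ' c n, mul_assoc, ← wp_const_mul]
    refine hc _ _ _ _ (fun N R => ?_) _ _
    dsimp only
    rw [← expect_const_mul]
    exact (expect_sq_le _ _).trans (expect_mono _ fun v => ih _)

/-! ### Many copies are rarely inaccurate at the same time -/

/-- In a run in which the copies in `S` are not used, their seeds are independent of the
transcript, so that the copies in `S` are all bad with probability at most `10 ^ (-|S|)`. -/
theorem expect_all_bad_unused (bad : A.Seed → PhasePos X Upd → Prop)
    (hbad : ∀ q, expect A.seed (fun v => ind (bad v q)) ≤ 10⁻¹) (D S : Finset ℕ)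
    (hS : S ⊆ Finset.range k) (hD : Disjoint D S) (n : ℕ) (q : PhasePos X Upd) :
    expect (seedsLaw A k) (fun r => expect (phaseLaw A act adv st k x₀ x₁ D r n q)
      (fun q' => ∏ j ∈ S, ind (bad (r j) q'))) ≤ 10⁻¹ ^ S.card := by
  classical
  induction S using Finset.induction_on with
  | empty => simp [expect_const]
  | insert j S hj ih =>
    have hjk : j < k := Finset.mem_range.1 (hS (Finset.mem_insert_self j S))
    have hjD : j ∉ D := fun h =>
      Finset.disjoint_left.1 hD h (Finset.mem_insert_self j S)
    rw [expect_seedsLaw_resample A k j hjk]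
    have e (r : ℕ → A.Seed) (v : A.Seed) :
        expect (phaseLaw A act adv st k x₀ x₁ D (Function.update r j v) n q)
          (fun q' => ∏ i ∈ insert j S, ind (bad (Function.update r j v i) q'))
        = expect (phaseLaw A act adv st k x₀ x₁ D r n q)
          (fun q' => ind (bad v q') * ∏ i ∈ S, ind (bad (r i) q')) := by
      rw [phaseLaw_congr D (r' := r) (fun i hi =>
        Function.update_of_ne (ne_of_mem_of_not_mem hi hjD) _ _)]
      congr 1; funext q'
      rw [Finset.prod_insert hj, Function.update_self]
      congr 1
      refine Finset.prod_congr rfl fun i hi => ?_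
      rw [Function.update_of_ne (ne_of_mem_of_not_mem hi hj)]
    simp only [e]
    rw [Finset.card_insert_of_notMem hj, pow_succ']
    calc _ ≤ expect (seedsLaw A k) (fun r => 10⁻¹ * expect (phaseLaw A act adv st k x₀ x₁ D r n q)
          (fun q' => ∏ i ∈ S, ind (bad (r i) q'))) := by
          refine expect_mono _ fun r => ?_
          rw [expect_comm, ← expect_const_mul]
          refine expect_mono _ fun q' => ?_
          conv_lhs => enter [2, v]; rw [mul_comm]
          rw [expect_const_mul, mul_comm]
          gcongr
          exact hbad q'
      _ ≤ _ := by
          rw [expect_const_mul]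
          gcongr
          exact ih (fun i hi => hS (Finset.mem_insert_of_mem hi))
            (hD.mono_right (Finset.subset_insert j S))

theorem slotsOf_sdiff (r : ℕ → A.Seed) (D S : Finset ℕ) (us : List Upd) :
    ∀ j ∉ S, slotsOf A D r x₁ us j = slotsOf A (D \ S) r x₁ us j := by
  intro j hj
  simp [slotsOf, hj]

/-- The true run, where the copies in `S` are used, compared with the run where they are not. -/
theorem expect_all_bad_sq_le (bad : A.Seed → PhasePos X Upd → Prop)
    (hbad : ∀ q, expect A.seed (fun v => ind (bad v q)) ≤ 10⁻¹) (S : Finset ℕ)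
    (hS : S ⊆ Finset.range k) {c : ℝ≥0∞}
    (hc : ∀ (r : ℕ → A.Seed) (us : List Upd) (v : Upd), SqBound A (inputAfter act x₁ us) (some v)
      (slotsOf A (Finset.range k) r x₁ us) (slotsOf A (Finset.range k \ S) r x₁ us) c st)
    (n : ℕ) (q : PhasePos X Upd) :
    expect (seedsLaw A k) (fun r => expect (phaseLaw A act adv st k x₀ x₁ (Finset.range k) r n q)
      (fun q' => ∏ j ∈ S, ind (bad (r j) q'))) ^ 2 ≤ c ^ n * 10⁻¹ ^ S.card := by
  calc _ ≤ expect (seedsLaw A k) (fun r => c ^ n * expect (phaseLaw A act adv st k x₀ x₁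
        (Finset.range k \ S) r n q) (fun q' => ∏ j ∈ S, ind (bad (r j) q'))) := by
        refine (expect_sq_le _ _).trans (expect_mono _ fun r => ?_)
        refine (phaseLaw_sq_le _ (Finset.range k \ S) r (hc r) n q _).trans ?_
        simp only [← Finset.prod_pow, ind_sq, le_refl]
    _ ≤ _ := by
        rw [expect_const_mul]
        gcongr
        exact expect_all_bad_unused bad hbad _ S hS Finset.sdiff_disjoint n q

theorem choose_mul_pow_le (k m B : ℕ) (hm : 40 * m ≤ k) (hB : 2 * k ≤ 5 * B) :
    (k.choose m : ℝ) * (3 / 8) ^ m ≤ B.choose m := by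
  have hf : (0 : ℝ) < m.factorial := by exact_mod_cast m.factorial_pos
  have h1 : ((m.factorial * k.choose m : ℕ) : ℝ) ≤ (k : ℝ) ^ m := by
    rw [← Nat.descFactorial_eq_factorial_mul_choose]
    exact_mod_cast Nat.descFactorial_le_pow k m
  have h2 : ((B + 1 - m : ℕ) : ℝ) ^ m ≤ ((m.factorial * B.choose m : ℕ) : ℝ) := by
    rw [← Nat.descFactorial_eq_factorial_mul_choose]
    exact_mod_cast Nat.pow_sub_le_descFactorial B m
  have h3 : (k : ℝ) * (3 / 8) ≤ ((B + 1 - m : ℕ) : ℝ) := by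
    rw [Nat.cast_sub (by omega)]
    have : (40 : ℝ) * m ≤ k := by exact_mod_cast hm
    have : (2 : ℝ) * k ≤ 5 * B := by exact_mod_cast hB
    push_cast
    linarith
  push_cast at h1 h2
  refine le_of_mul_le_mul_left ?_ hf
  calc (m.factorial : ℝ) * (k.choose m * (3 / 8) ^ m)
      = m.factorial * k.choose m * (3 / 8) ^ m := by ring
    _ ≤ (k : ℝ) ^ m * (3 / 8) ^ m := by gcongr
    _ = (k * (3 / 8) : ℝ) ^ m := by rw [mul_pow]
    _ ≤ ((B + 1 - m : ℕ) : ℝ) ^ m := by gcongr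
    _ ≤ _ := h2

open Classical in
/-- If two fifths of the copies are bad, then so is every copy of a noticeable fraction of all sets
of `m` copies; averaging over these sets bounds the probability of the former. -/
theorem expect_many_bad_sq_le (bad : A.Seed → PhasePos X Upd → Prop)
    (hbad : ∀ q, expect A.seed (fun v => ind (bad v q)) ≤ 10⁻¹) (m : ℕ) (hm : 40 * m ≤ k)
    {c : ℝ≥0∞}
    (hc : ∀ S ⊆ Finset.range k, S.card = m → ∀ (r : ℕ → A.Seed) (us : List Upd) (v : Upd),
      SqBound A (inputAfter act x₁ us) (some v)
        (slotsOf A (Finset.range k) r x₁ us) (slotsOf A (Finset.range k \ S) r x₁ us) c st)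
    (n : ℕ) (q : PhasePos X Upd) :
    expect (seedsLaw A k) (fun r => expect (phaseLaw A act adv st k x₀ x₁ (Finset.range k) r n q)
      (fun q' => ind (2 * k ≤ 5 * ((Finset.range k).filter fun j => bad (r j) q').card))) ^ 2
      ≤ c ^ n * ENNReal.ofReal (32 / 45) ^ m := by
  set E : (Finset ℕ) → ℝ≥0∞ := fun S => expect (seedsLaw A k) (fun r =>
    expect (phaseLaw A act adv st k x₀ x₁ (Finset.range k) r n q)
      (fun q' => ∏ j ∈ S, ind (bad (r j) q'))) with hE
  set P := expect (seedsLaw A k) (fun r => expect (phaseLaw A act adv st k x₀ x₁ (Finset.range k) r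
    n q) (fun q' => ind (2 * k ≤ 5 * ((Finset.range k).filter fun j => bad (r j) q').card))) with hP
  set B := (2 * k + 4) / 5 with hB
  have hne : (Finset.powersetCard m (Finset.range k)).Nonempty := by
    rw [Finset.powersetCard_nonempty, Finset.card_range]; omega
  have hsum : (B.choose m : ℝ≥0∞) * P ≤ ∑ S ∈ Finset.powersetCard m (Finset.range k), E S := by
    rw [hP, hE, ← expect_const_mul, ← expect_sum]
    refine expect_mono _ fun r => ?_
    rw [← expect_const_mul, ← expect_sum]
    refine expect_mono _ fun q' => ?_
    by_cases h : 2 * k ≤ 5 * ((Finset.range k).filter fun j => bad (r j) q').card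
    · rw [ind_true h, mul_one]
      set F := (Finset.range k).filter fun j => bad (r j) q' with hF
      calc (B.choose m : ℝ≥0∞) ≤ (F.card.choose m : ℕ) := by
            exact_mod_cast Nat.choose_le_choose m (by omega)
        _ = ∑ S ∈ Finset.powersetCard m F, ∏ j ∈ S, ind (bad (r j) q') := by
            rw [← Finset.card_powersetCard, Finset.card_eq_sum_ones, Nat.cast_sum]
            refine Finset.sum_congr rfl fun S hS => ?_
            rw [Finset.prod_congr rfl (g := fun _ => 1) fun j hj => ?_]
            · simp
            · exact ind_true (Finset.mem_filter.1 ((Finset.mem_powersetCard.1 hS).1 hj)).2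
        _ ≤ _ := Finset.sum_le_sum_of_subset (Finset.powersetCard_mono (Finset.filter_subset _ _))
    · rw [ind_false h, mul_zero]; exact zero_le
  obtain ⟨S, hS, hmax⟩ := Finset.exists_max_image _ E hne
  obtain ⟨hSk, hSm⟩ := Finset.mem_powersetCard.1 hS
  have h1 : (B.choose m : ℝ≥0∞) * P ≤ k.choose m * E S := by
    refine hsum.trans ((Finset.sum_le_card_nsmul _ _ _ hmax).trans (le_of_eq ?_))
    rw [Finset.card_powersetCard, Finset.card_range, nsmul_eq_mul]
  have h2 : E S ^ 2 ≤ c ^ n * 10⁻¹ ^ m := by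
    rw [← hSm]; exact expect_all_bad_sq_le bad hbad S hSk (hc S hSk hSm) n q
  have h3 : (k.choose m : ℝ≥0∞) * ENNReal.ofReal (3 / 8) ^ m ≤ B.choose m := by
    rw [← ENNReal.ofReal_pow (by norm_num), ← ENNReal.ofReal_natCast, ← ENNReal.ofReal_natCast,
      ← ENNReal.ofReal_mul (by positivity)]
    exact ENNReal.ofReal_le_ofReal (choose_mul_pow_le k m B hm (by omega))
  have hk0 : (k.choose m : ℝ≥0∞) ≠ 0 := by
    exact_mod_cast (Nat.choose_pos (by omega)).ne'
  have h4 : ENNReal.ofReal (3 / 8) ^ m * P ≤ E S := by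
    refine (ENNReal.mul_le_mul_iff_right hk0 (ENNReal.natCast_ne_top _)).1 ?_
    rw [← mul_assoc]
    exact (mul_le_mul_left h3 _).trans h1
  have h5 : ENNReal.ofReal (9 / 64) ^ m * P ^ 2 ≤ c ^ n * 10⁻¹ ^ m := by
    refine le_trans (le_of_eq ?_) ((pow_le_pow_left' h4 2).trans h2)
    rw [mul_pow, ← pow_mul, mul_comm m 2, pow_mul, ← ENNReal.ofReal_pow (n := 2) (by norm_num)]
    norm_num
  have h6 : ENNReal.ofReal (64 / 9) ^ m * ENNReal.ofReal (9 / 64) ^ m = 1 := by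
    rw [← mul_pow, ← ENNReal.ofReal_mul (by norm_num)]; norm_num
  have h7 : ENNReal.ofReal (64 / 9) * 10⁻¹ = ENNReal.ofReal (32 / 45) := by
    rw [← ENNReal.ofReal_ofNat, ← ENNReal.ofReal_inv_of_pos (by norm_num),
      ← ENNReal.ofReal_mul (by norm_num)]
    norm_num
  calc P ^ 2 = ENNReal.ofReal (64 / 9) ^ m * (ENNReal.ofReal (9 / 64) ^ m * P ^ 2) := by
        rw [← mul_assoc, h6, one_mul]
    _ ≤ ENNReal.ofReal (64 / 9) ^ m * (c ^ n * 10⁻¹ ^ m) := by gcongr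
    _ = c ^ n * ENNReal.ofReal (32 / 45) ^ m := by rw [← h7, mul_pow]; ring

end Phase

/-! ### Running times -/

/-- Expressions whose values are bounded independently of the memory. -/
def NExpr.IsBounded : NExpr → Prop
  | .lit _ => True
  | .get _ => False
  | .add a b => a.IsBounded ∧ b.IsBounded
  | .sub a _ => a.IsBounded

/-- A bound for the values of a bounded expression. -/
def NExpr.bound : NExpr → ℕ
  | .lit n => n
  | .get _ => 0
  | .add a b => a.bound + b.bound
  | .sub a _ => a.bound

theorem NExpr.eval_le_bound (N : ℕ → ℕ) (e : NExpr) (h : e.IsBounded) : e.eval N ≤ e.bound := by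
  induction e with
  | lit n => exact le_rfl
  | get a => exact h.elim
  | add a b iha ihb => exact add_le_add (iha h.1) (ihb h.2)
  | sub a b iha _ => exact (Nat.sub_le _ _).trans (iha h)

/-- Statements that leave the slots and the integer cell `0` unchanged, and whose loops have
bounded numbers of rounds. -/
def Stmt.IsPassive : Stmt → Prop
  | .skip => True
  | .setN (.lit a) _ => a ≠ 0
  | .setN _ _ => False
  | .setR _ _ => True
  | .flip (.lit a) => a ≠ 0
  | .flip _ => False
  | .seq s t => s.IsPassive ∧ t.IsPassive
  | .ite _ s t => s.IsPassive ∧ t.IsPassive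
  | .loop n b => n.IsBounded ∧ b.IsPassive
  | .start _ => False
  | .feed _ => False
  | .ask _ _ => True

/-- A bound for the running time of a passive statement, if queries take time at most `tq`. -/
def Stmt.timeBound (tq : ℕ) : Stmt → ℕ
  | .skip => 1
  | .setN a e => a.size + e.size + 1
  | .setR a e => a.size + e.size + 1
  | .flip a => a.size + 1
  | .seq s t => s.timeBound tq + t.timeBound tq
  | .ite c s t => c.size + (s.timeBound tq + t.timeBound tq) + 1
  | .loop n b => n.size + n.bound * (b.timeBound tq + 1) + 1
  | .start _ => 0
  | .feed _ => 0
  | .ask j a => j.size + a.size + tq + 1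

section Time

variable {X Upd : Type*} {A : DynAlg X Upd} {x : X} {u : Option Upd}

theorem Stmt.IsPassive.exec_support {s : Stmt} (hs : s.IsPassive) (tq : ℕ) (m : Mem A.State)
    (q : Mem A.State × ℕ) (hq : q ∈ (s.exec A x u m).support) :
    q.1.slot = m.slot ∧ q.1.nat 0 = m.nat 0 ∧
      ((∀ j t, m.slot j = some t → (A.queryTime t : ℕ) ≤ tq) → q.2 ≤ s.timeBound tq) := by
  classical
  induction s generalizing m q with
  | skip =>
    simp only [Stmt.exec, PMF.support_pure, Set.mem_singleton_iff] at hq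
    subst hq
    exact ⟨rfl, rfl, fun _ => le_rfl⟩
  | setN a e =>
    simp only [Stmt.exec, PMF.support_pure, Set.mem_singleton_iff] at hq
    subst hq
    cases a with
    | lit a => exact ⟨rfl, by simp [NExpr.eval, Function.update_of_ne (Ne.symm hs)],
        fun _ => le_rfl⟩
    | _ => exact hs.elim
  | setR a e =>
    simp only [Stmt.exec, PMF.support_pure, Set.mem_singleton_iff] at hq
    subst hq
    exact ⟨rfl, rfl, fun _ => le_rfl⟩
  | flip a =>
    simp only [Stmt.exec, PMF.mem_support_map_iff] at hq
    obtain ⟨b, -, rfl⟩ := hq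
    cases a with
    | lit a => exact ⟨rfl, by simp [NExpr.eval, Function.update_of_ne (Ne.symm hs)],
        fun _ => le_rfl⟩
    | _ => exact hs.elim
  | seq s t ihs iht =>
    simp only [Stmt.exec, PMF.mem_support_bind_iff, PMF.mem_support_map_iff] at hq
    obtain ⟨p, hp, q', hq', rfl⟩ := hq
    obtain ⟨h1, h2, h3⟩ := ihs hs.1 m p hp
    obtain ⟨k1, k2, k3⟩ := iht hs.2 p.1 q' hq'
    exact ⟨k1.trans h1, k2.trans h2, fun h => add_le_add (h3 h) (k3 (by rwa [h1]))⟩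
  | ite c s t ihs iht =>
    simp only [Stmt.exec, PMF.mem_support_map_iff] at hq
    obtain ⟨q', hq', rfl⟩ := hq
    simp only [Stmt.timeBound]
    split_ifs at hq'
    · obtain ⟨h1, h2, h3⟩ := ihs hs.1 m q' hq'
      exact ⟨h1, h2, fun h => by have := h3 h; omega⟩
    · obtain ⟨h1, h2, h3⟩ := iht hs.2 m q' hq'
      exact ⟨h1, h2, fun h => by have := h3 h; omega⟩
  | loop n b ih =>
    simp only [Stmt.exec, PMF.mem_support_map_iff] at hq
    obtain ⟨q', hq', rfl⟩ := hq
    have key : ∀ (i : ℕ) (m : Mem A.State) (q : Mem A.State × ℕ),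
        q ∈ (iterRun (b.exec A x u) i m).support →
        q.1.slot = m.slot ∧ q.1.nat 0 = m.nat 0 ∧
          ((∀ j t, m.slot j = some t → (A.queryTime t : ℕ) ≤ tq) →
            q.2 ≤ i * (b.timeBound tq + 1)) := by
      intro i
      induction i with
      | zero =>
        intro m q hq
        simp only [iterRun, PMF.support_pure, Set.mem_singleton_iff] at hq
        subst hq
        exact ⟨rfl, rfl, fun _ => by simp⟩
      | succ i ihi =>
        intro m q hq
        simp only [iterRun, PMF.mem_support_bind_iff, PMF.mem_support_map_iff] at hq
        obtain ⟨p, hp, q', hq', rfl⟩ := hq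
        obtain ⟨h1, h2, h3⟩ := ih hs.2 m p hp
        obtain ⟨k1, k2, k3⟩ := ihi p.1 q' hq'
        refine ⟨k1.trans h1, k2.trans h2, fun h => ?_⟩
        have e1 := h3 h
        have e2 := k3 (by rwa [h1])
        dsimp only
        rw [add_mul, one_mul]
        omega
    obtain ⟨h1, h2, h3⟩ := key _ _ _ hq'
    refine ⟨h1, h2, fun h => ?_⟩
    have e1 := h3 h
    have e2 := Nat.mul_le_mul_right (b.timeBound tq + 1) (NExpr.eval_le_bound m.nat n hs.1)
    simp only [Stmt.timeBound]
    omega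
  | start j => exact hs.elim
  | feed j => exact hs.elim
  | ask j a =>
    simp only [Stmt.exec] at hq
    split at hq
    · next t ht =>
      simp only [PMF.support_pure, Set.mem_singleton_iff] at hq
      subst hq
      refine ⟨rfl, rfl, fun h => ?_⟩
      have := h _ _ ht
      simp only [Stmt.timeBound]
      omega
    · simp only [PMF.support_pure, Set.mem_singleton_iff] at hq
      subst hq
      refine ⟨rfl, rfl, fun h => ?_⟩
      simp only [Stmt.timeBound]
      omega

theorem searchBoth_isPassive (w s d : ℕ) (b v₀ : ℝ) : (searchBoth w s d b v₀).IsPassive := by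
  simp [searchBoth, signedSearch, searchLevel, setThreshold, countVotes, sample, noisyBit, drawBit,
    Stmt.IsPassive, NExpr.IsBounded]

theorem searchBoth_timeBound_le (w s d tq : ℕ) (b v₀ : ℝ) :
    (searchBoth w s d b v₀).timeBound tq ≤ 200 * (d + 1) * (s + d + 1) * (w + tq + 1) := by
  simp only [searchBoth, signedSearch, searchLevel, setThreshold, countVotes, sample, noisyBit,
    drawBit, Stmt.timeBound, NExpr.bound, NExpr.size, RExpr.size, Test.size, ncell, rcell]
  ring_nf
  nlinarith [Nat.zero_le (d * s), Nat.zero_le (d * s * w), Nat.zero_le (d * s * tq),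
    Nat.zero_le (d * d), Nat.zero_le (d * d * w), Nat.zero_le (d * d * tq), Nat.zero_le (d * w),
    Nat.zero_le (d * tq), Nat.zero_le (s * w), Nat.zero_le (s * tq)]

theorem advance_exec_support (T : ℕ) (m : Mem A.State) (q : Mem A.State × ℕ)
    (hq : q ∈ ((advance T).exec A x u m).support) :
    q.1.slot = m.slot ∧ q.1.real = m.real ∧
      q.1.nat 0 = (if m.nat 0 + 1 < T then m.nat 0 + 1 else 0) ∧ q.2 ≤ 14 := by
  classical
  simp only [advance, Stmt.exec, PMF.mem_support_bind_iff, PMF.mem_support_map_iff,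
    PMF.support_pure, Set.mem_singleton_iff] at hq
  obtain ⟨_, rfl, q', ⟨q'', hq', rfl⟩, rfl⟩ := hq
  simp only [Test.Holds, NExpr.eval, ncell, Function.update_self] at hq'
  split_ifs at hq' with h <;>
    simp only [PMF.support_pure, Set.mem_singleton_iff] at hq' <;> subst hq' <;>
    simp [h, NExpr.size, Test.size, ncell]

/-- The effect and the time of a response. -/
theorem respond_exec_support (T w s d tq : ℕ) (b v₀ : ℝ) (m : Mem A.State) (q : Mem A.State × ℕ)
    (hq : q ∈ ((respond T w s d b v₀).exec A x u m).support) :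
    q.1.slot = m.slot ∧ q.1.nat 0 = (if m.nat 0 + 1 < T then m.nat 0 + 1 else 0) ∧
      ((∀ j t, m.slot j = some t → (A.queryTime t : ℕ) ≤ tq) →
        q.2 ≤ 200 * (d + 1) * (s + d + 1) * (w + tq + 1) + 14) := by
  simp only [respond, Stmt.exec, PMF.mem_support_bind_iff, PMF.mem_support_map_iff] at hq
  obtain ⟨p, hp, q', hq', rfl⟩ := hq
  obtain ⟨h1, h2, h3⟩ := (searchBoth_isPassive w s d b v₀).exec_support tq m p hp
  obtain ⟨k1, -, k2, k3⟩ := advance_exec_support T p.1 q' hq'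
  refine ⟨k1.trans h1, by rw [k2, h2], fun h => ?_⟩
  have := (h3 h).trans (searchBoth_timeBound_le w s d tq b v₀)
  exact add_le_add this k3

theorem stateAfter_append (r : A.Seed) (y : X) (us : List Upd) (v : Upd) :
    A.stateAfter r y (us ++ [v]) = A.update (A.stateAfter r y us) v := by
  simp [DynAlg.stateAfter]

theorem updatesTime_append (t : A.State) (us vs : List Upd) :
    A.updatesTime t (us ++ vs) = A.updatesTime t us + A.updatesTime (us.foldl A.update t) vs := by
  induction us generalizing t with
  | nil => simp [DynAlg.updatesTime]
  | cons v us ih => simp [DynAlg.updatesTime, ih]; ring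

theorem totalTime_append (r : A.Seed) (y : X) (us : List Upd) (v : Upd) :
    A.totalTime r y (us ++ [v])
      = A.totalTime r y us + A.updateTime (A.stateAfter r y us) v := by
  simp [DynAlg.totalTime, updatesTime_append, DynAlg.updatesTime, DynAlg.stateAfter]; ring

theorem startAll_exec_support (k : ℕ) (N : ℕ → ℕ) (R : ℕ → ℝ) (σ : ℕ → Option A.State)
    (hσ : ∀ j, k ≤ j → σ j = none) (q : Mem A.State × ℕ)
    (hq : q ∈ ((startAll k).exec A x u ⟨N, R, σ⟩).support) :
    ∃ r : ℕ → A.Seed, (∀ j, r j ∈ A.seed.support) ∧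
      q.1 = ⟨Function.update N 1 k, R, slotsOf A (Finset.range k) r x []⟩ ∧
      q.2 = ∑ j ∈ Finset.range k, A.totalTime (r j) x [] + 10 * k + 5 := by
  simp only [startAll, Stmt.exec, PMF.mem_support_bind_iff, PMF.mem_support_map_iff,
    PMF.support_pure, Set.mem_singleton_iff] at hq
  obtain ⟨_, rfl, q', ⟨q'', hq, rfl⟩, rfl⟩ := hq
  simp only [NExpr.eval] at hq
  have key : ∀ (n i : ℕ) (r : ℕ → A.Seed) (q : Mem A.State × ℕ), (∀ j, r j ∈ A.seed.support) →
      q ∈ (iterRun (startOne.exec A x u) n ⟨Function.update N 1 i, R,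
          fun j => if j < i then some (A.init (r j) x) else σ j⟩).support →
      ∃ r' : ℕ → A.Seed, (∀ j, r' j ∈ A.seed.support) ∧ (∀ j < i, r' j = r j) ∧
        q.1 = ⟨Function.update N 1 (i + n), R,
          fun j => if j < i + n then some (A.init (r' j) x) else σ j⟩ ∧
        q.2 = ∑ j ∈ Finset.range n, (A.initTime (r' (i + j)) x : ℕ) + 10 * n := by
    intro n
    induction n with
    | zero =>
      intro i r q hr hq
      simp only [iterRun, PMF.support_pure, Set.mem_singleton_iff] at hq
      subst hq
      exact ⟨r, hr, fun _ _ => rfl, rfl, by simp⟩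
    | succ n ih =>
      intro i r q hr hq
      simp only [iterRun, PMF.mem_support_bind_iff, PMF.mem_support_map_iff] at hq
      obtain ⟨p, hp, q', hq', rfl⟩ := hq
      simp only [startOne, Stmt.exec, PMF.mem_support_bind_iff, PMF.mem_support_map_iff,
        PMF.support_pure, Set.mem_singleton_iff] at hp
      obtain ⟨_, ⟨v, hv, rfl⟩, _, rfl, rfl⟩ := hp
      simp only [NExpr.eval, ncell, Function.update_self, Function.update_idem] at hq'
      have e : Function.update (fun j => if j < i then some (A.init (r j) x) else σ j) i
          (some (A.init v x)) = fun j => if j < i + 1 then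
            some (A.init (Function.update r i v j) x) else σ j := by
        funext j
        rcases lt_trichotomy j i with h | rfl | h
        · simp [h.ne, h, h.trans (Nat.lt_succ_self i)]
        · simp
        · simp [h.ne', not_lt.2 h.le, not_lt.2 (Nat.succ_le_of_lt h)]
      rw [e] at hq'
      have hr' : ∀ j, Function.update r i v j ∈ A.seed.support := by
        intro j
        by_cases h : j = i
        · subst h; rwa [Function.update_self]
        · rw [Function.update_of_ne h]; exact hr j
      obtain ⟨r', h1, h2, h3, h4⟩ := ih (i + 1) _ q' hr' hq'
      refine ⟨r', h1, fun j hj => ?_, ?_, ?_⟩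
      · rw [h2 j (by omega), Function.update_of_ne hj.ne]
      · rw [h3, show i + 1 + n = i + (n + 1) by ring]
      · rw [h4, Finset.sum_range_succ' _ n]
        have : r' i = v := by rw [h2 i (by omega), Function.update_self]
        simp only [NExpr.size, ncell, this, add_zero]
        have e2 : ∀ j, i + 1 + j = i + (j + 1) := fun j => by ring
        simp only [e2]
        ring
  obtain ⟨r', h1, -, h3, h4⟩ := key k 0 (fun _ => A.seed.support_nonempty.some) q''
    (fun _ => A.seed.support_nonempty.some_mem) (by simpa using hq)
  refine ⟨r', h1, ?_, ?_⟩
  · dsimp only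
    rw [h3, zero_add]
    congr 1
    funext j
    simp only [slotsOf, Finset.mem_range]
    split_ifs with h
    · rfl
    · exact hσ j (not_lt.1 h)
  · simp only [h4, NExpr.size, zero_add, DynAlg.totalTime, DynAlg.updatesTime, add_zero]
    ring

theorem feedAll_exec (k : ℕ) (N : ℕ → ℕ) (R : ℕ → ℝ) (r : ℕ → A.Seed) (x₁ : X) (us : List Upd)
    (v : Upd) :
    (feedAll k).exec A x (some v) ⟨N, R, slotsOf A (Finset.range k) r x₁ us⟩
      = PMF.pure (⟨Function.update N 1 k, R, slotsOf A (Finset.range k) r x₁ (us ++ [v])⟩,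
        ∑ j ∈ Finset.range k, (A.updateTime (A.stateAfter (r j) x₁ us) v : ℕ) + 10 * k + 5) := by
  have key : ∀ (n i : ℕ), i + n ≤ k →
      iterRun (feedOne.exec A x (some v)) n ⟨Function.update N 1 i, R,
          fun j => if j < i then slotsOf A (Finset.range k) r x₁ (us ++ [v]) j
            else slotsOf A (Finset.range k) r x₁ us j⟩
      = PMF.pure (⟨Function.update N 1 (i + n), R,
          fun j => if j < i + n then slotsOf A (Finset.range k) r x₁ (us ++ [v]) j
            else slotsOf A (Finset.range k) r x₁ us j⟩,
          ∑ j ∈ Finset.range n, (A.updateTime (A.stateAfter (r (i + j)) x₁ us) v : ℕ)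
            + 10 * n) := by
    intro n
    induction n with
    | zero => intro i _; simp [iterRun]
    | succ n ih =>
      intro i hi
      have hs : (fun j => if j < i then slotsOf A (Finset.range k) r x₁ (us ++ [v]) j
            else slotsOf A (Finset.range k) r x₁ us j) i = some (A.stateAfter (r i) x₁ us) := by
        simp [slotsOf, show i < k by omega]
      have e : Function.update (fun j => if j < i then slotsOf A (Finset.range k) r x₁ (us ++ [v]) j
            else slotsOf A (Finset.range k) r x₁ us j) i
          (some (A.update (A.stateAfter (r i) x₁ us) v))
          = fun j => if j < i + 1 then slotsOf A (Finset.range k) r x₁ (us ++ [v]) j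
            else slotsOf A (Finset.range k) r x₁ us j := by
        funext j
        rcases lt_trichotomy j i with h | rfl | h
        · simp [h.ne, h, h.trans (Nat.lt_succ_self i)]
        · simp [slotsOf, show j < k by omega, stateAfter_append]
        · simp [h.ne', not_lt.2 h.le, not_lt.2 (Nat.succ_le_of_lt h)]
      have ho : feedOne.exec A x (some v) ⟨Function.update N 1 i, R,
          fun j => if j < i then slotsOf A (Finset.range k) r x₁ (us ++ [v]) j
            else slotsOf A (Finset.range k) r x₁ us j⟩
          = PMF.pure (⟨Function.update N 1 (i + 1), R,
          fun j => if j < i + 1 then slotsOf A (Finset.range k) r x₁ (us ++ [v]) j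
            else slotsOf A (Finset.range k) r x₁ us j⟩,
            (A.updateTime (A.stateAfter (r i) x₁ us) v : ℕ) + 9) := by
        simp only [feedOne, Stmt.exec, NExpr.eval, ncell, Function.update_self, hs, PMF.pure_bind,
          PMF.pure_map, Function.update_idem, e]
        congr 2
        simp only [NExpr.size]
        ring
      have e2 : ∀ j, i + 1 + j = i + (j + 1) := fun j => by ring
      rw [iterRun, ho, PMF.pure_bind, ih (i + 1) (by omega), PMF.pure_map,
        Finset.sum_range_succ' _ n]
      simp only [e2, add_zero]
      congr 2
      ring
  have h0 := key k 0 (by omega)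
  simp only [not_lt_zero, if_false, zero_add] at h0
  simp only [feedAll, Stmt.exec, PMF.pure_bind, NExpr.eval]
  rw [h0]
  simp only [PMF.pure_map]
  congr 2
  · congr 1
    funext j
    simp only [slotsOf, Finset.mem_range]
    split_ifs <;> rfl
  · simp only [NExpr.size]; ring

end Time

/-! ### The phases of the game -/

section Game

variable {X Upd : Type*} {A : DynAlg X Upd} {act : Upd → X → X} {adv : Adversary X Upd}
  {g : X → ℝ} {T tTotal tq w s d : ℕ} {b v₀ γ : ℝ}

/-- One round of the game with the step program `st`, as an operator on functions of the current
input, the rounds and the memory. -/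
noncomputable def turn (A : DynAlg X Upd) (act : Upd → X → X) (adv : Adversary X Upd) (st : Stmt)
    (x₀ : X) (F : X → List (Round X Upd) → Mem A.State → ℝ≥0∞) (x : X) (l : List (Round X Upd))
    (m : Mem A.State) : ℝ≥0∞ :=
  expect (adv.next x₀ l) fun v => wp A (act v x) (some v) st
    (fun m' => F (act v x) (l ++ [⟨v, act v x, m'.real 0⟩]) m') m

theorem expect_play_add (P : Program) (n i : ℕ)
    (F : X → X → List (Round X Upd) → Mem A.State → ℝ≥0∞) :
    expect (P.play A act adv (n + i)) (fun p => F p.initial p.current p.rounds p.mem)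
      = expect (P.play A act adv n) fun p =>
          (turn A act adv P.step p.initial)^[i] (F p.initial) p.current p.rounds p.mem := by
  induction i generalizing F with
  | zero => rfl
  | succ i ih =>
    have h : expect (P.play A act adv (n + (i + 1)))
        (fun p => F p.initial p.current p.rounds p.mem)
        = expect (P.play A act adv (n + i)) fun p =>
          turn A act adv P.step p.initial (F p.initial) p.current p.rounds p.mem := by
      simp only [Program.play, expect_bind, expect_map, turn, wp]
      rfl
    rw [h, ih fun x₀ => turn A act adv P.step x₀ (F x₀)]
    simp only [← Function.iterate_succ_apply]

theorem play_support_length (P : Program) (n : ℕ) (p : Position X Upd A.State)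
    (hp : p ∈ (P.play A act adv n).support) : p.rounds.length = n := by
  induction n generalizing p with
  | zero =>
    simp only [Program.play, PMF.mem_support_bind_iff, PMF.mem_support_map_iff] at hp
    obtain ⟨_, -, _, -, rfl⟩ := hp
    rfl
  | succ n ih =>
    simp only [Program.play, PMF.mem_support_bind_iff, PMF.mem_support_map_iff] at hp
    obtain ⟨p', hp', _, -, _, -, rfl⟩ := hp
    simp [ih p' hp']

theorem totalTime_le (hA : A.ObliviousGuarantee act g T γ tTotal tq) (r : A.Seed)
    (hr : r ∈ A.seed.support) (y : X) (us : List Upd) (hus : us.length ≤ T) (v : Upd) :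
    A.totalTime r y us ≤ tTotal := by
  refine le_trans ?_ (hA.total_time r hr y (us ++ List.replicate (T - us.length) v) (by simp; omega))
  simp only [DynAlg.totalTime, updatesTime_append]
  omega

/-- The memory and the running time after `n` rounds. Within a phase, the slots hold copies that
have processed the updates of the phase, and the time that is not covered by finished phases and
by the overhead `β` of each round is the time of these copies. -/
structure PlayInv (A : DynAlg X Upd) (T k tTotal β n : ℕ) (p : Position X Upd A.State) : Prop where
  counter : p.mem.nat 0 = n % T
  slots : ∀ j, k ≤ j → p.mem.slot j = none
  time_zero : n % T = 0 → p.time ≤ 1 + n / T * (k * tTotal) + n * β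
  time_pos : n % T ≠ 0 → ∃ (r : ℕ → A.Seed) (x₁ : X) (us : List Upd),
    (∀ j, r j ∈ A.seed.support) ∧ us.length + 1 = n % T ∧
      p.mem.slot = slotsOf A (Finset.range k) r x₁ us ∧
      p.time ≤ 1 + n / T * (k * tTotal) + n * β
        + ∑ j ∈ Finset.range k, A.totalTime (r j) x₁ us

/-- The invariant is preserved by a round, once the copies of the round are known. -/
theorem PlayInv.of_respond (hT : 1 ≤ T) (hA : A.ObliviousGuarantee act g T γ tTotal tq)
    {k n β t₀ : ℕ} {p : Position X Upd A.State} {x : X} {v : Upd}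
    {r : ℕ → A.Seed} (hr : ∀ j, r j ∈ A.seed.support) {x₁ : X} {us : List Upd}
    (hus : us.length = n % T) {N : ℕ → ℕ} (hN : N 0 = n % T) {R : ℕ → ℝ} {q : Mem A.State × ℕ}
    (hq : q ∈ ((respond T w s d b v₀).exec A x (some v)
      ⟨N, R, slotsOf A (Finset.range k) r x₁ us⟩).support)
    (hmem : p.mem = q.1)
    (htime : p.time ≤ 1 + n / T * (k * tTotal) + n * β
      + ∑ j ∈ Finset.range k, A.totalTime (r j) x₁ us + t₀ + q.2)
    (ht₀ : 200 * (d + 1) * (s + d + 1) * (w + tq + 1) + 14 + t₀ ≤ β) :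
    PlayInv A T k tTotal β (n + 1) p := by
  have hlt : n % T < T := Nat.mod_lt _ (by omega)
  obtain ⟨h1, h2, h3⟩ := respond_exec_support T w s d tq b v₀ _ q hq
  have h4 := h3 fun j t ht => by
    simp only [slotsOf] at ht
    split_ifs at ht with hj
    cases ht
    exact hA.query_time (r j) (hr j) x₁ us (by omega)
  simp only [hN] at h1 h2
  have hmod := Nat.div_add_mod n T
  have hs : ∀ j, k ≤ j → p.mem.slot j = none := by
    intro j hj
    rw [hmem, h1]
    simp [slotsOf, not_lt.2 hj]
  by_cases hc : n % T + 1 < T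
  · have e1 : (n + 1) % T = n % T + 1 := by
      rw [Nat.add_mod, Nat.mod_eq_of_lt (show 1 < T by omega), Nat.mod_eq_of_lt hc]
    have e2 : (n + 1) / T = n / T := by
      rw [Nat.add_div (by omega), Nat.mod_eq_of_lt (show 1 < T by omega),
        Nat.div_eq_of_lt (show 1 < T by omega), if_neg (by omega)]
      rfl
    rw [if_pos hc] at h2
    refine ⟨by rw [hmem, h2, e1], hs, fun h => by omega, fun _ => ⟨r, x₁, us, hr, by omega,
      by rw [hmem, h1], ?_⟩⟩
    rw [e2, add_mul n 1 β, one_mul]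
    omega
  · have e0 : n % T + 1 = T := by omega
    have e1 : (n + 1) % T = 0 := by
      rw [← hmod, add_assoc, e0]; simp
    have e2 : (n + 1) / T = n / T + 1 := by
      have : n + 1 = T * (n / T + 1) := by rw [mul_add, mul_one]; omega
      rw [this, Nat.mul_div_cancel_left _ (by omega)]
    rw [if_neg hc] at h2
    have hsum : ∑ j ∈ Finset.range k, A.totalTime (r j) x₁ us ≤ k * tTotal := by
      refine (Finset.sum_le_card_nsmul _ _ tTotal fun j _ =>
        totalTime_le hA (r j) (hr j) x₁ us (by omega) v).trans ?_
      simp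
    refine ⟨by rw [hmem, h2, e1], hs, fun _ => ?_, fun h => absurd e1 h⟩
    rw [e2, add_mul n 1 β, add_mul (n / T) 1, one_mul, one_mul]
    omega

theorem play_support_inv (hT : 1 ≤ T) (hA : A.ObliviousGuarantee act g T γ tTotal tq) (n : ℕ)
    (p : Position X Upd A.State)
    (hp : p ∈ ((robustProgram T w s d b v₀).play A act adv n).support) :
    PlayInv A T (2 ^ w) tTotal
      (200 * (d + 1) * (s + d + 1) * (w + tq + 1) + 14 + (10 * 2 ^ w + 10)) n p := by
  induction n generalizing p with
  | zero =>
    simp only [Program.play, robustProgram, Stmt.exec, PMF.mem_support_bind_iff,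
      PMF.mem_support_map_iff, PMF.support_pure, Set.mem_singleton_iff] at hp
    obtain ⟨_, -, _, rfl, rfl⟩ := hp
    exact ⟨by simp [Mem.blank], fun _ _ => rfl, fun _ => by simp, fun h => absurd (by simp) h⟩
  | succ n ih =>
    simp only [Program.play, PMF.mem_support_bind_iff, PMF.mem_support_map_iff] at hp
    obtain ⟨p', hp', v, -, q, hq, rfl⟩ := hp
    have hinv := ih p' hp'
    obtain ⟨x₀, x, l, ⟨N, R, σ⟩, t⟩ := p'
    obtain ⟨i1, i2, i3, i4⟩ := hinv
    dsimp only at i1 i2 i3 i4 hq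
    simp only [robustProgram, Stmt.exec, PMF.mem_support_bind_iff, PMF.mem_support_map_iff] at hq
    obtain ⟨_, ⟨q₁, hq₁, rfl⟩, q₂, hq₂, rfl⟩ := hq
    simp only [Test.Holds, NExpr.eval, ncell, i1] at hq₁
    split_ifs at hq₁ with hc
    · have h0 : n % T = 0 := by omega
      obtain ⟨r, hr, e1, e2⟩ := startAll_exec_support (2 ^ w) N R σ i2 q₁ hq₁
      dsimp only at hq₂
      rw [e1] at hq₂
      refine PlayInv.of_respond (t₀ := 10 * 2 ^ w + 10) hT hA hr (us := [])
        (by simp [h0]) (by simpa using i1) hq₂ rfl ?_ le_rfl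
      have := i3 h0
      dsimp only
      simp only [e2, Test.size, NExpr.size, ncell]
      omega
    · have h0 : n % T ≠ 0 := by omega
      obtain ⟨r, x₁, us, hr, hus, hslot, ht⟩ := i4 h0
      rw [hslot, feedAll_exec, PMF.support_pure, Set.mem_singleton_iff] at hq₁
      subst hq₁
      refine PlayInv.of_respond (t₀ := 10 * 2 ^ w + 10) hT hA hr (us := us ++ [v])
        (by simpa using hus) (by simpa using i1) hq₂ rfl ?_ le_rfl
      dsimp only
      simp only [totalTime_append, Finset.sum_add_distrib, Test.size, NExpr.size, ncell]
      omega

/-! ### The failure probability of a round -/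

theorem wp_congr_support {x : X} {u : Option Upd} {st : Stmt} {f f' : Mem A.State → ℝ≥0∞}
    {m : Mem A.State} (h : ∀ q ∈ (st.exec A x u m).support, f q.1 = f' q.1) :
    wp A x u st f m = wp A x u st f' m := expect_congr h

theorem wp_startAll (x : X) (u : Option Upd) (k : ℕ) (f : Mem A.State → ℝ≥0∞) (N : ℕ → ℕ)
    (R : ℕ → ℝ) (σ : ℕ → Option A.State) (hσ : ∀ j, k ≤ j → σ j = none) :
    wp A x u (startAll k) f ⟨N, R, σ⟩ = expect (seedsLaw A k) fun r =>
      f ⟨Function.update N 1 k, R, slotsOf A (Finset.range k) r x []⟩ := by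
  have key : ∀ (n : ℕ) (f : Mem A.State → ℝ≥0∞),
      (wp A x u startOne)^[n] f ⟨Function.update N 1 0, R, σ⟩ = expect (seedsLaw A n) fun r =>
        f ⟨Function.update N 1 n, R, fun j => if j < n then some (A.init (r j) x) else σ j⟩ := by
    intro n
    induction n with
    | zero => intro f; simp [seedsLaw, expect_pure]
    | succ n ih =>
      intro f
      rw [Function.iterate_succ_apply, ih]
      simp only [seedsLaw, expect_bind, expect_map, startOne, wp_seq, wp_start, wp_setN,
        NExpr.eval, ncell, Function.update_self, Function.update_idem]
      congr 1; funext r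
      congr 1; funext v
      congr 2
      funext j
      rcases lt_trichotomy j n with h | rfl | h
      · simp [h.ne, h, h.trans (Nat.lt_succ_self n)]
      · simp
      · simp [h.ne', not_lt.2 h.le, not_lt.2 (Nat.succ_le_of_lt h)]
  rw [startAll, wp_seq, wp_setN, wp_loop]
  simp only [NExpr.eval]
  rw [key]
  congr 1; funext r
  congr 2; funext j
  simp only [slotsOf, Finset.mem_range]
  split_ifs with h
  · rfl
  · exact hσ j (not_lt.1 h)

theorem wp_feedAll (x : X) (k : ℕ) (f : Mem A.State → ℝ≥0∞) (N : ℕ → ℕ)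
    (R : ℕ → ℝ) (r : ℕ → A.Seed) (x₁ : X) (us : List Upd) (v : Upd) :
    wp A x (some v) (feedAll k) f ⟨N, R, slotsOf A (Finset.range k) r x₁ us⟩
      = f ⟨Function.update N 1 k, R, slotsOf A (Finset.range k) r x₁ (us ++ [v])⟩ := by
  rw [wp, feedAll_exec, expect_pure]

theorem inputAfter_append (y : X) (us : List Upd) (v : Upd) :
    inputAfter act y (us ++ [v]) = act v (inputAfter act y us) := by
  simp [inputAfter]

/-- The rest of a phase, in terms of the law of its transcript for fixed seeds. -/
theorem wp_respond_iterate_turn (r : ℕ → A.Seed) (x₀ x₁ : X)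
    (F : X → List (Round X Upd) → Mem A.State → ℝ≥0∞) (n : ℕ) (q : PhasePos X Upd)
    (hq : q.nat 0 + n < T) :
    wp A (inputAfter act x₁ q.us) (some q.upd) (respond T w s d b v₀) (fun m =>
        (turn A act adv (robustProgram T w s d b v₀).step x₀)^[n] F (inputAfter act x₁ q.us)
          (q.rounds ++ [⟨q.upd, inputAfter act x₁ q.us, m.real 0⟩]) m)
      ⟨q.nat, q.real, slotsOf A (Finset.range (2 ^ w)) r x₁ q.us⟩
    = expect (phaseLaw A act adv (respond T w s d b v₀) (2 ^ w) x₀ x₁ (Finset.range (2 ^ w)) r n q)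
      fun q' => wp A (inputAfter act x₁ q'.us) (some q'.upd) (respond T w s d b v₀)
        (fun m => F (inputAfter act x₁ q'.us)
          (q'.rounds ++ [⟨q'.upd, inputAfter act x₁ q'.us, m.real 0⟩]) m)
        ⟨q'.nat, q'.real, slotsOf A (Finset.range (2 ^ w)) r x₁ q'.us⟩ := by
  induction n generalizing q with
  | zero => simp only [phaseLaw, expect_pure, Function.iterate_zero, id_eq]
  | succ n ih =>
    rw [phaseLaw, expect_bind, expect_phaseStep]
    refine wp_congr_support fun ⟨⟨N', R', σ'⟩, t⟩ hp => ?_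
    obtain ⟨h1, h2, -⟩ := respond_exec_support T w s d 0 b v₀ _ _ hp
    dsimp only at h1 h2
    rw [if_pos (by omega)] at h2
    subst h1
    rw [Function.iterate_succ_apply', turn]
    congr 1; funext v
    have hstep : (robustProgram T w s d b v₀).step = .seq (.ite (.ltN (ncell 0) (.lit 1))
      (startAll (2 ^ w)) (feedAll (2 ^ w))) (respond T w s d b v₀) := rfl
    rw [← inputAfter_append (act := act), ← ih ⟨q.us ++ [v], _, v, _, R'⟩ (by
      dsimp only
      rw [Function.update_of_ne (by simp), h2]; omega)]
    conv_lhs => rw [hstep, wp_seq, wp_ite]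
    rw [if_neg (by simp [Test.Holds, NExpr.eval, ncell, h2]), wp_feedAll]
    rfl

/-- The guarantee against oblivious adversaries, for one position in a phase. -/
theorem expect_inaccurate_le (hA : A.ObliviousGuarantee act g T γ tTotal tq) (x₁ : X)
    (us : List Upd) :
    expect A.seed (fun v => ind (us.length ≤ T ∧
      ¬IsApprox γ (g (inputAfter act x₁ us)) (A.query (A.stateAfter v x₁ us)))) ≤ 10⁻¹ := by
  by_cases h : us.length ≤ T
  · have h1 := hA.accurate x₁ us h
    rw [toOuterMeasure_eq_expect] at h1
    have h2 := expect_ind_add_not A.seed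
      (fun v => IsApprox γ (g (inputAfter act x₁ us)) (A.query (A.stateAfter v x₁ us)))
    simp only [h, true_and]
    have e : (9 / 10 : ℝ≥0∞) + 10⁻¹ = 1 := by
      rw [← one_div, ENNReal.div_add_div_same, show (9 + 1 : ℝ≥0∞) = 10 by norm_num,
        ENNReal.div_self (by norm_num) (by norm_num)]
    have e9 : (9 / 10 : ℝ≥0∞) ≠ ⊤ := ENNReal.div_ne_top (by norm_num) (by norm_num)
    refine (ENNReal.add_le_add_iff_left e9).1 ?_
    rw [e, ← h2]
    gcongr
  · simp only [h, false_and, ind_false not_false, expect_const]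
    exact zero_le

/-- In a phase, the output of every fixed round is inaccurate with small probability: either many
copies are inaccurate, or one of the votes fails. -/
theorem iterate_turn_inaccurate_le (hA : A.ObliviousGuarantee act g T γ tTotal tq)
    (hb : 1 < b) (hv : 0 < v₀) {U : ℝ} (hU : U ≤ v₀ * b ^ 2 ^ d) (hlow : v₀ * b < 1 / U)
    (hU1 : 1 < U) (hg : ∀ x, g x ∈ Set.Icc (-U) (-(1 / U)) ∪ {0} ∪ Set.Icc (1 / U) U)
    {M : ℕ} (hM : 40 * M ≤ 2 ^ w) {y : ℝ≥0∞}
    (hy : ∀ n < T, (ENNReal.ofReal (1 + 4 / 3 * (M / 2 ^ w) ^ 2) ^ (2 * d * s)) ^ n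
      * ENNReal.ofReal (32 / 45) ^ M ≤ y ^ 2) (n : ℕ) (hn : n < T) (x₀ x : X)
    (l : List (Round X Upd)) (m : Mem A.State) (hm0 : m.nat 0 = 0)
    (hm : ∀ j, 2 ^ w ≤ j → m.slot j = none) :
    (turn A act adv (robustProgram T w s d b v₀).step x₀)^[n + 1]
      (fun _ l _ => ind (∃ rd ∈ l.getLast?, ¬IsApprox (γ * b) (g rd.input) rd.output)) x l m
      ≤ y + 2 * d * ENNReal.ofReal (199 / 200) ^ s := by
  classical
  rw [Function.iterate_succ_apply', turn]
  refine (expect_mono _ fun v => ?_).trans (expect_const _ _).le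
  have hstep : (robustProgram T w s d b v₀).step = .seq (.ite (.ltN (ncell 0) (.lit 1))
    (startAll (2 ^ w)) (feedAll (2 ^ w))) (respond T w s d b v₀) := rfl
  conv_lhs => rw [hstep, wp_seq, wp_ite]
  rw [if_pos (by simp [Test.Holds, NExpr.eval, ncell, hm0])]
  obtain ⟨N, R, σ⟩ := m
  dsimp only at hm0 hm
  rw [wp_startAll _ _ _ _ _ _ _ hm]
  set x₁ := act v x with hx₁
  let q₀ : PhasePos X Upd := ⟨[], l, v, Function.update N 1 (2 ^ w), R⟩
  let bad : A.Seed → PhasePos X Upd → Prop := fun r q => q.us.length ≤ T ∧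
    ¬IsApprox γ (g (inputAfter act x₁ q.us)) (A.query (A.stateAfter r x₁ q.us))
  have hlink (r : ℕ → A.Seed) := wp_respond_iterate_turn (act := act) (adv := adv) (T := T)
    (w := w) (s := s) (d := d) (b := b) (v₀ := v₀) r x₀ x₁
    (fun _ l _ => ind (∃ rd ∈ l.getLast?, ¬IsApprox (γ * b) (g rd.input) rd.output)) n q₀
    (by simpa [q₀, hm0] using hn)
  refine (expect_mono _ fun r => (hlink r).le).trans ?_
  have hround (r : ℕ → A.Seed) (q : PhasePos X Upd) (hq : q.us.length ≤ T) :
      wp A (inputAfter act x₁ q.us) (some q.upd) (respond T w s d b v₀) (fun m => ind (∃ rd ∈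
          (q.rounds ++ [(⟨q.upd, inputAfter act x₁ q.us, m.real 0⟩ : Round X Upd)]).getLast?,
          ¬IsApprox (γ * b) (g rd.input) rd.output))
        ⟨q.nat, q.real, slotsOf A (Finset.range (2 ^ w)) r x₁ q.us⟩
      ≤ ind (2 * 2 ^ w ≤ 5 * ((Finset.range (2 ^ w)).filter fun j => bad (r j) q).card)
        + 2 * d * ENNReal.ofReal (199 / 200) ^ s := by
    by_cases hmany : 2 * 2 ^ w ≤ 5 * ((Finset.range (2 ^ w)).filter fun j => bad (r j) q).card
    · rw [ind_true hmany]
      refine le_trans ?_ le_self_add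
      exact (wp_mono _ (fun _ => ind_le_one _) _).trans (wp_const _ _ _).le
    · refine le_trans ?_ le_add_self
      have hfil : ((Finset.range (2 ^ w)).filter fun j => ¬IsApprox γ
          (g (inputAfter act x₁ q.us)) (answer A (slotsOf A (Finset.range (2 ^ w)) r x₁ q.us j)))
          = (Finset.range (2 ^ w)).filter fun j => bad (r j) q := by
        refine Finset.filter_congr fun j hj => ?_
        simp [bad, hq, slotsOf, Finset.mem_range.1 hj, answer]
      have htr := (searchBoth_triple (A := A) (x := inputAfter act x₁ q.us) (u := some q.upd)
        (σ := slotsOf A (Finset.range (2 ^ w)) r x₁ q.us)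
        w s d γ (g (inputAfter act x₁ q.us)) b U v₀ (q.nat 0) hb hv hU hlow hU1 (hg _)
        (by rw [hfil]; exact not_le.1 hmany)).seq (t := advance T) (ε' := 0)
        (R := fun m => IsApprox (γ * b) (g (inputAfter act x₁ q.us)) (m.real 0))
        ((Triple.setN fun _ h => h).seq (Triple.ite (ε := 0) (Triple.skip fun _ h => h.1)
          (Triple.setN fun _ h => h.1)) |>.weaken (fun _ h => h) (by simp) (fun _ h => h))
      refine le_trans (wp_mono _ (fun m => ind_mono ?_) _) ((htr
        ⟨q.nat, q.real, slotsOf A (Finset.range (2 ^ w)) r x₁ q.us⟩ ⟨rfl, rfl⟩).trans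
        (add_zero _).le)
      rintro ⟨rd, hrd, hbad⟩
      simp only [List.getLast?_append, List.getLast?_singleton, Option.some_or,
        Option.mem_def, Option.some.injEq] at hrd
      subst hrd
      exact hbad
  have hmono (r : ℕ → A.Seed) := expect_mono_support
    (p := phaseLaw A act adv (respond T w s d b v₀) (2 ^ w) x₀ x₁ (Finset.range (2 ^ w)) r n q₀)
    (fun q' hq' => hround r q' (by
      have := phaseLaw_length _ _ _ _ _ hq'
      simp only [q₀, List.length_nil, zero_add] at this
      omega))
  refine (expect_mono _ hmono).trans ?_
  simp only [expect_add, expect_const]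
  gcongr
  have hsq := expect_many_bad_sq_le (A := A) (act := act) (adv := adv)
    (st := respond T w s d b v₀) (k := 2 ^ w) (x₀ := x₀) (x₁ := x₁) bad
    (fun q => expect_inaccurate_le hA x₁ q.us) M hM
    (c := ENNReal.ofReal (1 + 4 / 3 * (M / 2 ^ w) ^ 2) ^ (2 * d * s))
    (fun S _ hS r us v => by
      rw [← hS]
      exact (SqBound.sample w S (slotsOf_sdiff r _ S us)).respond T s d b v₀) n q₀
  by_contra hlt
  refine absurd (le_trans (le_of_eq ?_) (hsq.trans (hy n hn))) (not_le.2 (ENNReal.pow_lt_pow_left two_ne_zero (not_le.1 hlt)))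
  congr!

/-- The failure probability of a phase, by a union bound over its rounds. -/
theorem expect_not_accurateOn_le (hT : 1 ≤ T) (hA : A.ObliviousGuarantee act g T γ tTotal tq)
    (hb : 1 < b) (hv : 0 < v₀) {U : ℝ} (hU : U ≤ v₀ * b ^ 2 ^ d) (hlow : v₀ * b < 1 / U)
    (hU1 : 1 < U) (hg : ∀ x, g x ∈ Set.Icc (-U) (-(1 / U)) ∪ {0} ∪ Set.Icc (1 / U) U)
    {M : ℕ} (hM : 40 * M ≤ 2 ^ w) {y : ℝ≥0∞}
    (hy : ∀ n < T, (ENNReal.ofReal (1 + 4 / 3 * (M / 2 ^ w) ^ 2) ^ (2 * d * s)) ^ n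
      * ENNReal.ofReal (32 / 45) ^ M ≤ y ^ 2) (n i : ℕ) :
    expect ((robustProgram T w s d b v₀).play A act adv n) (fun p =>
      ind (¬AccurateOn g (γ * b) (Set.Ico (i * T) ((i + 1) * T)) p.rounds))
      ≤ T * (y + 2 * d * ENNReal.ofReal (199 / 200) ^ s) := by
  set P := robustProgram T w s d b v₀ with hP
  let wrong (j : ℕ) (l : List (Round X Upd)) : Prop :=
    ∃ rd ∈ l[j]?, ¬IsApprox (γ * b) (g rd.input) rd.output
  -- Once a round is over, later rounds do not change whether its output is accurate.
  have hpersist (j n : ℕ) (hj : j < n) :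
      expect (P.play A act adv n) (fun p => ind (wrong j p.rounds))
        = expect (P.play A act adv (j + 1)) (fun p => ind (wrong j p.rounds)) := by
    induction n, Nat.succ_le_of_lt hj using Nat.le_induction with
    | base => rfl
    | succ n hn ih =>
      rw [← ih (by omega), expect_play_add P n 1 (fun _ _ l _ => ind (wrong j l))]
      refine expect_congr fun p hp => ?_
      have hlen := play_support_length P n p hp
      have hw (rd : Round X Upd) : wrong j (p.rounds ++ [rd]) ↔ wrong j p.rounds := by
        simp only [wrong]
        rw [List.getElem?_append_left (by omega)]
      simp only [Function.iterate_one, turn, hw, wp_const, expect_const]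
  have hround (j n : ℕ) (h1 : i * T ≤ j) (h2 : j < (i + 1) * T) (hj : j < n) :
      expect (P.play A act adv n) (fun p => ind (wrong j p.rounds))
        ≤ y + 2 * d * ENNReal.ofReal (199 / 200) ^ s := by
    obtain ⟨τ, rfl⟩ := Nat.exists_eq_add_of_le h1
    have hτ : τ < T := by rw [add_mul, one_mul] at h2; omega
    rw [hpersist _ n hj]
    have e : expect (P.play A act adv (i * T + τ + 1)) (fun p => ind (wrong (i * T + τ) p.rounds))
        = expect (P.play A act adv (i * T + (τ + 1))) (fun p =>
          ind (∃ rd ∈ p.rounds.getLast?, ¬IsApprox (γ * b) (g rd.input) rd.output)) := by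
      rw [← add_assoc]
      refine expect_congr fun p hp => ?_
      have hlen := play_support_length P _ p hp
      simp only [wrong]
      rw [List.getLast?_eq_getElem?, hlen, Nat.add_sub_cancel]
    rw [e, expect_play_add P (i * T) (τ + 1) (fun _ _ l _ =>
      ind (∃ rd ∈ l.getLast?, ¬IsApprox (γ * b) (g rd.input) rd.output))]
    refine (expect_mono_support fun p hp => ?_).trans (expect_const _ _).le
    have hinv := play_support_inv hT hA _ p hp
    exact iterate_turn_inaccurate_le hA hb hv hU hlow hU1 hg hM hy τ hτ _ _ _ _
      (by rw [hinv.counter]; simp) hinv.slots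
  calc _ ≤ expect (P.play A act adv n) (fun p =>
        ∑ j ∈ (Finset.Ico (i * T) ((i + 1) * T)).filter (· < n), ind (wrong j p.rounds)) := by
        refine expect_mono_support fun p hp => ?_
        have hlen := play_support_length P n p hp
        by_cases hacc : AccurateOn g (γ * b) (Set.Ico (i * T) ((i + 1) * T)) p.rounds
        · rw [ind_false (not_not.2 hacc)]; exact zero_le
        · rw [ind_true hacc]
          unfold AccurateOn at hacc
          push Not at hacc
          obtain ⟨j, hj, hj', hj''⟩ := hacc
          have hw : wrong j p.rounds := ⟨p.rounds[j], by simp [hj], hj''⟩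
          rw [← ind_true hw]
          exact Finset.single_le_sum (f := fun j => ind (wrong j p.rounds)) (fun _ _ => zero_le)
            (Finset.mem_filter.2 ⟨Finset.mem_Ico.2 hj', by omega⟩)
    _ ≤ ∑ j ∈ (Finset.Ico (i * T) ((i + 1) * T)).filter (· < n),
        (y + 2 * d * ENNReal.ofReal (199 / 200) ^ s) := by
        rw [expect_sum]
        refine Finset.sum_le_sum fun j hj => ?_
        obtain ⟨hj1, hj2⟩ := Finset.mem_filter.1 hj
        obtain ⟨hj1, hj3⟩ := Finset.mem_Ico.1 hj1
        exact hround j n hj1 hj3 hj2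
    _ ≤ _ := by
        rw [Finset.sum_const, nsmul_eq_mul]
        gcongr
        refine (Finset.card_filter_le _ _).trans ?_
        rw [Nat.card_Ico, add_mul, one_mul, Nat.add_sub_cancel_left]

end Game

/-! ### Parameters -/

theorem threshold_covers {U α : ℝ} {d : ℕ} (hU : 1 < U) (hα : 0 < α)
    (hd : 2 * Real.log U * (1 + 1 / α) + 2 ≤ 2 ^ d) :
    U ≤ 1 / U / (1 + α) ^ 2 * (1 + α) ^ 2 ^ d := by
  have hb : 0 < 1 + α := by linarith
  have hlogU : 0 < Real.log U := Real.log_pos hU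
  have hlogb : 0 < Real.log (1 + α) := Real.log_pos (by linarith)
  have h1 : 1 ≤ (1 + 1 / α) * Real.log (1 + α) := by
    have h := Real.one_sub_inv_le_log_of_pos hb
    have e : 1 = (1 + 1 / α) * (1 - (1 + α)⁻¹) := by field_simp; ring
    calc 1 = (1 + 1 / α) * (1 - (1 + α)⁻¹) := e
      _ ≤ _ := by gcongr
  have h2 : U * U * (1 + α) ^ 2 ≤ (1 + α) ^ 2 ^ d := by
    rw [← Real.log_le_log_iff (by positivity) (by positivity), Real.log_mul (by positivity)
      (by positivity), Real.log_mul (by positivity) (by positivity), Real.log_pow, Real.log_pow]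
    push_cast
    calc Real.log U + Real.log U + 2 * Real.log (1 + α)
        = 2 * Real.log U * 1 + 2 * Real.log (1 + α) := by ring
      _ ≤ 2 * Real.log U * ((1 + 1 / α) * Real.log (1 + α)) + 2 * Real.log (1 + α) := by gcongr
      _ = (2 * Real.log U * (1 + 1 / α) + 2) * Real.log (1 + α) := by ring
      _ ≤ _ := by gcongr
  rw [div_div, div_mul_eq_mul_div, one_mul, le_div_iff₀ (by positivity)]
  linarith

/-- The sizes in terms of one logarithmic quantity `ℓ`: `d` levels of the search, `s` samples for
each vote, sets of `M` copies in the analysis, and `2 ^ w` copies, where `w` is minimal such that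
`2 * d * s * T` samples have a bounded effect on the transcript. -/
theorem exists_sizes (T ℓ : ℕ) (hT : 1 ≤ T) (hℓ : 1 ≤ ℓ) (hTℓ : T ≤ 2 ^ ℓ) :
    ∃ w s d M : ℕ, d = ℓ + 1 ∧ 40 * M ≤ 2 ^ w ∧
      (∀ n < T, (ENNReal.ofReal (1 + 4 / 3 * (M / 2 ^ w) ^ 2) ^ (2 * d * s)) ^ n
        * ENNReal.ofReal (32 / 45) ^ M ≤ (2⁻¹ ^ (ℓ + 1)) ^ 2) ∧
      2 * d * ENNReal.ofReal (199 / 200) ^ s ≤ 2⁻¹ ^ (ℓ + 1) ∧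
      s + d + 1 ≤ 803 * ℓ ∧ w ≤ 1000 * ℓ ∧ (2 ^ w : ℝ) ≤ 10 ^ 5 * ℓ ^ 3 * √T := by
  set d := ℓ + 1 with hd
  set s := 200 * (2 * ℓ + 2) with hs
  set M := 5 * (ℓ + 2) with hM
  set Q := T * (2 * d * s) * (M * M) with hQ
  set w := Nat.clog 4 Q with hw
  have hds : 1600 ≤ 2 * d * s := by
    calc 1600 = 2 * 1 * 800 := by norm_num
      _ ≤ 2 * d * s := by gcongr <;> omega
  have hk : Q ≤ 2 ^ w * 2 ^ w := by
    rw [← mul_pow]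
    exact Nat.le_pow_clog (by norm_num) Q
  have hM1 : 1 ≤ M := by omega
  have hQ1 : 1 < Q := by
    calc 1 < 1 * 1600 * (1 * 1) := by norm_num
      _ ≤ Q := by rw [hQ]; gcongr
  have hkr : (T : ℝ) * (2 * d * s : ℕ) * ((M : ℝ) * M) ≤ 2 ^ w * 2 ^ w := by exact_mod_cast hk
  refine ⟨w, s, d, M, rfl, ?_, ?_, ?_, by omega, ?_, ?_⟩
  · have h : (40 * M) * (40 * M) ≤ 2 ^ w * 2 ^ w := by
      calc (40 * M) * (40 * M) = 1 * 1600 * (M * M) := by ring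
        _ ≤ Q := by rw [hQ]; gcongr
        _ ≤ _ := hk
    exact Nat.mul_self_le_mul_self_iff.1 h
  · intro n hn
    set z : ℝ := 4 / 3 * (M / 2 ^ w) ^ 2 with hz
    have hz0 : 0 ≤ z := by positivity
    have hexp : (1 + z) ^ (2 * d * s * n) ≤ 4 := by
      have h1 : z * (2 * d * s * n : ℕ) ≤ 4 / 3 := by
        have h2 : ((2 * d * s * n : ℕ) : ℝ) ≤ T * (2 * d * s : ℕ) := by
          rw [mul_comm (2 * d * s) n]
          exact_mod_cast Nat.mul_le_mul_right _ hn.le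
        have h3 : ((M : ℝ) / 2 ^ w) ^ 2 * (T * (2 * d * s : ℕ)) ≤ 1 := by
          rw [div_pow, div_mul_eq_mul_div, div_le_one (by positivity)]
          linarith
        calc z * (2 * d * s * n : ℕ) ≤ z * (T * (2 * d * s : ℕ)) := by gcongr
          _ = 4 / 3 * ((M / 2 ^ w) ^ 2 * (T * (2 * d * s : ℕ))) := by rw [hz]; ring
          _ ≤ 4 / 3 * 1 := by gcongr
          _ = 4 / 3 := by ring
      have h4 : Real.exp (4 / 3) ≤ 4 := by
        have e : Real.exp (4 / 3) ^ 3 = Real.exp 1 ^ 4 := by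
          rw [← Real.exp_nat_mul, ← Real.exp_nat_mul]; norm_num
        have h5 : Real.exp 1 ^ 4 ≤ 4 ^ 3 := by
          calc Real.exp 1 ^ 4 ≤ 2.8 ^ 4 := by
                gcongr; exact (Real.exp_one_lt_d9.trans (by norm_num)).le
            _ ≤ 4 ^ 3 := by norm_num
        rw [← e] at h5
        exact le_of_pow_le_pow_left₀ (by norm_num) (by norm_num) h5
      calc (1 + z) ^ (2 * d * s * n) ≤ Real.exp z ^ (2 * d * s * n) := by
            gcongr; linarith [Real.add_one_le_exp z]
        _ = Real.exp (z * (2 * d * s * n : ℕ)) := by rw [← Real.exp_nat_mul, mul_comm]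
        _ ≤ Real.exp (4 / 3) := by gcongr
        _ ≤ 4 := h4
    have h5 : (32 / 45 : ℝ) ^ M ≤ (1 / 4) ^ (ℓ + 2) := by
      rw [hM, pow_mul]; gcongr; norm_num
    have e2 : (2⁻¹ : ℝ≥0∞) = ENNReal.ofReal (1 / 2) := by
      rw [one_div, ENNReal.ofReal_inv_of_pos (by norm_num), ENNReal.ofReal_ofNat]
    rw [← pow_mul, e2, ← ENNReal.ofReal_pow (by positivity), ← ENNReal.ofReal_pow (by positivity),
      ← ENNReal.ofReal_mul (by positivity), ← ENNReal.ofReal_pow (by positivity),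
      ← ENNReal.ofReal_pow (by positivity)]
    refine ENNReal.ofReal_le_ofReal ?_
    calc (1 + z) ^ (2 * d * s * n) * (32 / 45) ^ M ≤ 4 * (1 / 4) ^ (ℓ + 2) := by gcongr
      _ = ((1 / 2) ^ (ℓ + 1)) ^ 2 := by
          rw [← pow_mul, mul_comm (ℓ + 1) 2, pow_mul, pow_succ]; norm_num; ring
  · have h1 : ENNReal.ofReal (199 / 200) ^ 200 ≤ 2⁻¹ := by
      rw [← ENNReal.ofReal_pow (by norm_num), ← ENNReal.ofReal_ofNat,
        ← ENNReal.ofReal_inv_of_pos (by norm_num)]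
      refine ENNReal.ofReal_le_ofReal ?_
      norm_num
    have h2 : (2 * d : ℝ≥0∞) ≤ 2 ^ (ℓ + 1) := by
      have : 2 * d ≤ 2 ^ (ℓ + 1) := by
        rw [pow_succ']
        exact Nat.mul_le_mul_left 2 Nat.lt_two_pow_self
      exact_mod_cast this
    have h3 : (2 : ℝ≥0∞) ^ (ℓ + 1) * 2⁻¹ ^ (ℓ + 1) = 1 := by
      rw [← mul_pow, ENNReal.mul_inv_cancel (by norm_num) (by norm_num), one_pow]
    calc 2 * (d : ℝ≥0∞) * ENNReal.ofReal (199 / 200) ^ s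
        ≤ 2 ^ (ℓ + 1) * 2⁻¹ ^ (2 * ℓ + 2) := by
          rw [hs, pow_mul]; gcongr
      _ = 2 ^ (ℓ + 1) * 2⁻¹ ^ (ℓ + 1) * 2⁻¹ ^ (ℓ + 1) := by
          rw [mul_assoc, ← pow_add]; congr 2; ring
      _ = 2⁻¹ ^ (ℓ + 1) := by rw [h3, one_mul]
      _ ≤ _ := le_rfl
  · have hself : ∀ i : ℕ, i ≤ 4 ^ i := fun i => (Nat.lt_pow_self (by norm_num)).le
    have hT4 : T ≤ 4 ^ ℓ := hTℓ.trans (Nat.pow_le_pow_left (by norm_num) ℓ)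
    have : w ≤ ℓ + (1 + d + s) + (M + M) := by
      refine Nat.clog_le_of_le_pow ?_
      calc Q ≤ 4 ^ ℓ * (4 ^ 1 * 4 ^ d * 4 ^ s) * (4 ^ M * 4 ^ M) := by
            rw [hQ]
            gcongr
            · norm_num
            all_goals exact hself _
        _ = 4 ^ (ℓ + (1 + d + s) + (M + M)) := by simp only [pow_add]
    linarith only [this, hd.le, hs.le, hM.le, hℓ]
  · have hw1 : 4 ^ (w - 1) < Q := Nat.pow_pred_clog_lt_self (by norm_num) hQ1
    have hwpos : 0 < w := Nat.clog_pos (by norm_num) hQ1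
    have h1 : 2 ^ w * 2 ^ w ≤ 4 * Q := by
      rw [← mul_pow]
      calc (2 * 2) ^ w = 4 * 4 ^ (w - 1) := by
            rw [← pow_succ', Nat.sub_add_cancel hwpos]
        _ ≤ 4 * Q := by gcongr
    have h2 : (2 ^ w * 2 ^ w : ℝ) ≤ 4 * (T * (2 * d * s) * (M * M)) := by exact_mod_cast h1
    have hℓr : (1 : ℝ) ≤ ℓ := by exact_mod_cast hℓ
    have hdr : (d : ℝ) ≤ 2 * ℓ := by rw [hd]; push_cast; linarith
    have hsr : (s : ℝ) ≤ 800 * ℓ := by rw [hs]; push_cast; linarith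
    have hMr : (M : ℝ) ≤ 15 * ℓ := by rw [hM]; push_cast; linarith
    refine le_of_pow_le_pow_left₀ two_ne_zero (by positivity) ?_
    rw [sq]
    refine h2.trans ?_
    rw [mul_pow, Real.sq_sqrt (by positivity)]
    have hTr : (0 : ℝ) ≤ T := by positivity
    calc 4 * (T * (2 * d * s : ℝ) * (M * M))
        ≤ 4 * (T * (2 * (2 * ℓ) * (800 * ℓ)) * (15 * ℓ * (15 * ℓ))) := by gcongr
      _ = 2880000 * (ℓ : ℝ) ^ 4 * T := by ring
      _ ≤ 10 ^ 10 * (ℓ : ℝ) ^ 6 * T := by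
          gcongr
          · norm_num
          · norm_num
      _ = (10 ^ 5 * (ℓ : ℝ) ^ 3) ^ 2 * T := by ring

section Final

variable {X Upd : Type*} {A : DynAlg X Upd} {act : Upd → X → X} {adv : Adversary X Upd}
  {g : X → ℝ} {T tTotal tq w s d : ℕ} {b v₀ γ : ℝ}

theorem length_le_updatesTime (t : A.State) (us : List Upd) : us.length ≤ A.updatesTime t us := by
  induction us generalizing t with
  | nil => simp
  | cons v us ih =>
    have h1 := ih (A.update t v)
    have h2 := (A.updateTime t v).pos
    simp only [List.length_cons, DynAlg.updatesTime]
    omega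

/-- The total time, in terms of the guarantee of the given algorithm. -/
theorem play_time_le (hT : 1 ≤ T) (hA : A.ObliviousGuarantee act g T γ tTotal tq) {ℓ : ℕ}
    (hℓ : 1 ≤ ℓ) (hd : d = ℓ + 1) (hs : s + d + 1 ≤ 803 * ℓ) (hw : w ≤ 1000 * ℓ)
    (hk : (2 ^ w : ℝ) ≤ 10 ^ 5 * ℓ ^ 3 * √T) (n : ℕ) (p : Position X Upd A.State)
    (hp : p ∈ ((robustProgram T w s d b v₀).play A act adv n).support) :
    (p.time : ℝ) ≤ 10 ^ 9 * ℓ ^ 3 * (tTotal / √T + tq) * (max n T : ℕ) := by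
  obtain ⟨x, -⟩ := adv.first.support_nonempty
  obtain ⟨v, -⟩ := (adv.next x []).support_nonempty
  obtain ⟨r₀, hr₀⟩ := A.seed.support_nonempty
  have htT : T ≤ tTotal := by
    refine le_trans ?_ (hA.total_time r₀ hr₀ x (List.replicate T v) (by simp))
    have := length_le_updatesTime (A.init r₀ x) (List.replicate T v)
    rw [List.length_replicate] at this
    simp only [DynAlg.totalTime]
    omega
  have htq : 1 ≤ tq := le_trans (A.queryTime _).pos (hA.query_time r₀ hr₀ x [] (by simp))
  have hinv := play_support_inv hT hA n p hp
  set β := 200 * (d + 1) * (s + d + 1) * (w + tq + 1) + 14 + (10 * 2 ^ w + 10) with hβ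
  have htime : p.time ≤ 1 + (n / T + 1) * (2 ^ w * tTotal) + n * β := by
    rw [add_mul, one_mul]
    by_cases h0 : n % T = 0
    · have := hinv.time_zero h0
      omega
    · obtain ⟨r, x₁, us, hr, hus, -, ht⟩ := hinv.time_pos h0
      have hlt : n % T < T := Nat.mod_lt _ (by omega)
      have hsum : ∑ j ∈ Finset.range (2 ^ w), A.totalTime (r j) x₁ us ≤ 2 ^ w * tTotal := by
        refine (Finset.sum_le_card_nsmul _ _ tTotal fun j _ =>
          totalTime_le hA (r j) (hr j) x₁ us (by omega) v).trans ?_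
        simp
      omega
  set Mx : ℕ := max n T with hMx
  have hTr : (1 : ℝ) ≤ T := by exact_mod_cast hT
  have hsq : 0 < √(T : ℝ) := Real.sqrt_pos.2 (by linarith)
  have hss : √(T : ℝ) * √(T : ℝ) = T := Real.mul_self_sqrt (by linarith)
  have hℓr : (1 : ℝ) ≤ ℓ := by exact_mod_cast hℓ
  have hℓ3 : (1 : ℝ) ≤ (ℓ : ℝ) ^ 3 := one_le_pow₀ hℓr
  have htqr : (1 : ℝ) ≤ tq := by exact_mod_cast htq
  have hMT : (T : ℝ) ≤ Mx := by exact_mod_cast le_max_right n T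
  have hMn : (n : ℝ) ≤ Mx := by exact_mod_cast le_max_left n T
  have hM0 : (1 : ℝ) ≤ Mx := hTr.trans hMT
  set θ : ℝ := tTotal / √T with hθ
  have hθT : √(T : ℝ) ≤ θ := by
    rw [hθ, le_div_iff₀ hsq, hss]; exact_mod_cast htT
  have hθ0 : 0 ≤ θ := hsq.le.trans hθT
  have e1 : ((n / T : ℕ) + 1 : ℝ) * (2 ^ w * tTotal) ≤ 2 * 10 ^ 5 * ℓ ^ 3 * θ * Mx := by
    have h1 : ((n / T : ℕ) + 1 : ℝ) ≤ 2 * (Mx / T) := by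
      have h2 : ((n / T : ℕ) : ℝ) ≤ Mx / T :=
        Nat.cast_div_le.trans (by gcongr)
      have h3 : (1 : ℝ) ≤ Mx / T := by rw [le_div_iff₀ (by linarith)]; linarith
      linarith
    have h4 : (tTotal : ℝ) = θ * √T := by rw [hθ, div_mul_cancel₀ _ hsq.ne']
    calc ((n / T : ℕ) + 1 : ℝ) * (2 ^ w * tTotal)
        ≤ 2 * (Mx / T) * (10 ^ 5 * ℓ ^ 3 * √T * tTotal) := by gcongr
      _ = 2 * 10 ^ 5 * ℓ ^ 3 * θ * Mx * ((√T * √T) / T) := by rw [h4]; ring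
      _ = _ := by rw [hss, div_self (by linarith), mul_one]
  have e2 : (β : ℝ) ≤ 6 * 10 ^ 8 * ℓ ^ 3 * tq + 10 ^ 6 * ℓ ^ 3 * θ := by
    have h1 : (w + tq + 1 : ℝ) ≤ 1002 * ℓ * tq := by
      have : (w : ℝ) ≤ 1000 * ℓ := by exact_mod_cast hw
      nlinarith
    have h2 : (s + d + 1 : ℝ) ≤ 803 * ℓ := by exact_mod_cast hs
    have h3 : (d + 1 : ℝ) ≤ 3 * ℓ := by rw [hd]; push_cast; linarith
    have h4 : (200 * (d + 1) * (s + d + 1) * (w + tq + 1) : ℝ)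
        ≤ 200 * (3 * ℓ) * (803 * ℓ) * (1002 * ℓ * tq) := by gcongr
    have h5 : (1 : ℝ) ≤ ℓ ^ 3 * tq := one_le_mul_of_one_le_of_one_le hℓ3 htqr
    have h6 : (10 ^ 5 * ℓ ^ 3 * √T : ℝ) ≤ 10 ^ 5 * ℓ ^ 3 * θ := by gcongr
    rw [hβ]
    push_cast
    have e : 200 * (3 * (ℓ : ℝ)) * (803 * ℓ) * (1002 * ℓ * tq) = 482763600 * (ℓ ^ 3 * tq) := by ring
    rw [e] at h4
    linarith
  have e3 : (n : ℝ) * β ≤ Mx * (6 * 10 ^ 8 * ℓ ^ 3 * tq + 10 ^ 6 * ℓ ^ 3 * θ) := by gcongr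
  have e4 : (1 : ℝ) ≤ Mx * (ℓ ^ 3 * tq) :=
    one_le_mul_of_one_le_of_one_le hM0 (one_le_mul_of_one_le_of_one_le hℓ3 htqr)
  have e5 : (0 : ℝ) ≤ Mx * (ℓ ^ 3 * θ) := by positivity
  have htr : (p.time : ℝ) ≤ 1 + ((n / T : ℕ) + 1) * (2 ^ w * tTotal) + n * β := by
    exact_mod_cast htime
  calc (p.time : ℝ) ≤ 1 + ((n / T : ℕ) + 1) * (2 ^ w * tTotal) + n * β := htr
    _ ≤ Mx * (ℓ ^ 3 * tq) + 2 * 10 ^ 5 * ℓ ^ 3 * θ * Mx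
        + Mx * (6 * 10 ^ 8 * ℓ ^ 3 * tq + 10 ^ 6 * ℓ ^ 3 * θ) := by gcongr
    _ ≤ _ := by nlinarith

end Final

theorem theorem3p1 :
    ∃ (C : ℝ) (k : ℕ), 0 < C ∧
      ∀ (T : ℕ) (U α δ : ℝ), 1 ≤ T → 1 < U → 0 < α → 0 < δ →
      ∃ P : Program, (P.size : ℝ) ≤ C ∧
        ∀ (X Upd : Type*) (act : Upd → X → X) (g : X → ℝ),
          (∀ x, g x ∈ Set.Icc (-U) (-(1 / U)) ∪ {0} ∪ Set.Icc (1 / U) U) →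
        ∀ (A : DynAlg X Upd) (γ : ℝ) (tTotal tq : ℕ),
          A.ObliviousGuarantee act g T γ tTotal tq →
        ∀ adv : Adversary X Upd,
          -- the first `T` updates: accuracy of all outputs, and the total time
          (ENNReal.ofReal (1 - δ) ≤ (P.play A act adv T).toOuterMeasure
              {p | AccurateOn g (γ * (1 + α)) (Set.Iio T) p.rounds} ∧
            ∀ p ∈ (P.play A act adv T).support,
              (p.time : ℝ) ≤ C * Real.log (polylogArg T U α δ) ^ k *
                (Real.sqrt T * tTotal + T * tq)) ∧
          -- any number `n` of updates, in phases of `T` updates: accuracy in every phase, and the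
          -- amortized time
          ∀ n : ℕ,
            (∀ m : ℕ, ENNReal.ofReal (1 - δ) ≤ (P.play A act adv n).toOuterMeasure
              {p | AccurateOn g (γ * (1 + α)) (Set.Ico (m * T) ((m + 1) * T)) p.rounds}) ∧
            ∀ p ∈ (P.play A act adv n).support,
              (p.time : ℝ) ≤ C * Real.log (polylogArg T U α δ) ^ k *
                (tTotal / Real.sqrt T + tq) * (max n T : ℕ) := by
  refine ⟨10 ^ 11, 3, by norm_num, fun T U α δ hT hU hα hδ => ?_⟩
  set a := polylogArg T U α δ with ha
  have hTr : (1 : ℝ) ≤ T := by exact_mod_cast hT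
  have hlogU : 0 < Real.log U := Real.log_pos hU
  have hα' : 0 < 1 / α := by positivity
  have hδ' : 0 < 1 / δ := by positivity
  -- The terms of the argument of the logarithm that matter.
  have hprod : ∀ {p q r : ℝ}, p ≤ 1 + Real.log U → q ≤ 1 + 1 / α → r ≤ 1 + 1 / δ → 0 ≤ p → 0 ≤ q →
      0 ≤ r → 2 + T * p * q * r ≤ a := by
    intro p q r hp hq hr hp0 hq0 hr0
    rw [ha, polylogArg]
    gcongr
  have ha3 : 3 ≤ a := by
    have := hprod (p := 1) (q := 1) (r := 1) (by linarith) (by linarith) (by linarith) (by simp)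
      (by simp) (by simp)
    linarith
  have haT : (T : ℝ) ≤ a := by
    have := hprod (p := 1) (q := 1) (r := 1) (by linarith) (by linarith) (by linarith) (by simp)
      (by simp) (by simp)
    linarith
  have haδ : T * (1 / δ) ≤ a := by
    have := hprod (p := 1) (q := 1) (r := 1 / δ) (by linarith) (by linarith) (by linarith) (by simp)
      (by simp) hδ'.le
    linarith
  have haU : 2 + Real.log U * (1 + 1 / α) ≤ a := by
    have := hprod (p := Real.log U) (q := 1 + 1 / α) (r := 1) (by linarith) le_rfl (by linarith)
      hlogU.le (by positivity) (by simp)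
    have h2 : 1 * (Real.log U * (1 + 1 / α)) ≤ T * (Real.log U * (1 + 1 / α)) := by gcongr
    linarith
  set ℓ := ⌈2 * Real.log a⌉₊ with hℓ
  have hlog1 : 1 ≤ Real.log a := by
    rw [Real.le_log_iff_exp_le (by linarith)]
    linarith [Real.exp_one_lt_d9]
  have hℓlog : (ℓ : ℝ) ≤ 3 * Real.log a := by
    have := Nat.ceil_lt_add_one (show 0 ≤ 2 * Real.log a by linarith)
    linarith
  have hℓ1 : 1 ≤ ℓ := Nat.one_le_iff_ne_zero.2 (Nat.ceil_pos.2 (by linarith)).ne'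
  have haℓ : a ≤ 2 ^ ℓ := by
    rw [← Real.log_le_log_iff (by linarith) (by positivity), Real.log_pow]
    have h1 := Nat.le_ceil (2 * Real.log a)
    have h2 := Real.log_two_gt_d9
    have h3 : (ℓ : ℝ) * (1 / 2) ≤ ℓ * Real.log 2 := by gcongr; linarith
    linarith
  obtain ⟨w, s, d, M, hd, hM, hy, hvote, hs, hw, hk⟩ := exists_sizes T ℓ hT hℓ1
    (by exact_mod_cast haT.trans haℓ)
  have hUi : 0 < 1 / U := by positivity
  have hb : 1 < 1 + α := by linarith
  have hb0 : 0 < 1 + α := by linarith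
  have hv : 0 < 1 / U / (1 + α) ^ 2 := by positivity
  have hcover : U ≤ 1 / U / (1 + α) ^ 2 * (1 + α) ^ 2 ^ d := by
    refine threshold_covers hU hα ?_
    rw [hd, pow_succ]
    linarith
  have hlow : 1 / U / (1 + α) ^ 2 * (1 + α) < 1 / U := by
    rw [div_mul_eq_mul_div, div_lt_iff₀ (by positivity)]
    gcongr
    nlinarith
  refine ⟨robustProgram T w s d (1 + α) (1 / U / (1 + α) ^ 2), ?_, ?_⟩
  · have h : ((robustProgram T w s d (1 + α) (1 / U / (1 + α) ^ 2)).size : ℝ) ≤ (1000 : ℕ) := by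
      exact_mod_cast robustProgram_size T w s d (1 + α) (1 / U / (1 + α) ^ 2)
    exact h.trans (by norm_num)
  intro X Upd act g hg A γ tTotal tq hA adv
  set P := robustProgram T w s d (1 + α) (1 / U / (1 + α) ^ 2) with hP
  have hacc (n m : ℕ) : ENNReal.ofReal (1 - δ) ≤ (P.play A act adv n).toOuterMeasure
      {p | AccurateOn g (γ * (1 + α)) (Set.Ico (m * T) ((m + 1) * T)) p.rounds} := by
    have hfail := expect_not_accurateOn_le (adv := adv) hT hA hb hv hcover hlow hU hg hM hy n m
    have hle : T * ((2⁻¹ : ℝ≥0∞) ^ (ℓ + 1) + 2 * d * ENNReal.ofReal (199 / 200) ^ s)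
        ≤ ENNReal.ofReal δ := by
      have h1 : (2⁻¹ : ℝ≥0∞) ^ (ℓ + 1) + 2 * d * ENNReal.ofReal (199 / 200) ^ s
          ≤ ENNReal.ofReal ((1 / 2) ^ ℓ) := by
        refine (add_le_add_right hvote _).trans (le_of_eq ?_)
        rw [pow_succ, ← mul_add, ENNReal.inv_two_add_inv_two, mul_one,
          ENNReal.ofReal_pow (by norm_num), one_div, ENNReal.ofReal_inv_of_pos (by norm_num),
          ENNReal.ofReal_ofNat]
      refine (mul_le_mul_right h1 _).trans ?_
      rw [← ENNReal.ofReal_natCast, ← ENNReal.ofReal_mul (by positivity)]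
      refine ENNReal.ofReal_le_ofReal ?_
      rw [div_pow, one_pow, mul_one_div, div_le_iff₀ (by positivity)]
      calc (T : ℝ) = δ * (T * (1 / δ)) := by field_simp
        _ ≤ δ * 2 ^ ℓ := by gcongr; exact haδ.trans haℓ
    have hsum := expect_ind_add_not (P.play A act adv n) (fun p =>
      AccurateOn g (γ * (1 + α)) (Set.Ico (m * T) ((m + 1) * T)) p.rounds)
    rw [toOuterMeasure_eq_expect, ENNReal.ofReal_sub _ hδ.le, ENNReal.ofReal_one, ← hsum]
    refine tsub_le_iff_right.2 ?_
    gcongr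
    exact hfail.trans hle
  have htime (n : ℕ) (p : Position X Upd A.State) (hp : p ∈ (P.play A act adv n).support) :
      (p.time : ℝ) ≤ 10 ^ 11 * Real.log a ^ 3 * (tTotal / √T + tq) * (max n T : ℕ) := by
    refine (play_time_le hT hA hℓ1 hd hs hw hk n p hp).trans ?_
    gcongr ?_ * _ * _
    calc (10 : ℝ) ^ 9 * ℓ ^ 3 ≤ 10 ^ 9 * (3 * Real.log a) ^ 3 := by gcongr
      _ = 27 * 10 ^ 9 * Real.log a ^ 3 := by ring
      _ ≤ 10 ^ 11 * Real.log a ^ 3 := by gcongr; norm_num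
  refine ⟨⟨?_, fun p hp => ?_⟩, fun n => ⟨hacc n, htime n⟩⟩
  · have h := hacc T 0
    have e : Set.Ico (0 * T) ((0 + 1) * T) = Set.Iio T := by ext; simp
    rwa [e] at h
  · refine (htime T p hp).trans (le_of_eq ?_)
    have hsq : 0 < √(T : ℝ) := Real.sqrt_pos.2 (by linarith)
    have hss : √(T : ℝ) * √(T : ℝ) = T := Real.mul_self_sqrt (by linarith)
    rw [max_self, mul_assoc]
    congr 1
    have e : (tTotal : ℝ) / √T * T = √T * tTotal := by
      calc (tTotal : ℝ) / √T * T = tTotal / √T * (√T * √T) := by rw [hss]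
        _ = √T * tTotal := by field_simp
    rw [add_mul, e, mul_comm (tq : ℝ)]
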